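/- For a set $T$ let $\ell^\infty(T)$ be the space of bounded functions $T\to\mathbb R$ with the supremum norm. For a probability space $(\Omega,P)$ and bounded $f:\Omega\to\mathbb R$ let $E^*[f]=\inf\{E[U]: U\ge f,\ U \text{ measurable and integrable}\}$ and $E_*[f]=-E^*[-f]$ be the outer and inner expectation, and let $P^*$ be outer probability. For maps $X_n$, $Y_n$ (not necessarily measurable) from probability spaces, which may depend on $n$, into a metric space $D$: - $X_n$ converges weakly to a Borel probability law $L$ on $D$ if $E^*[f(X_n)]\to\int f\,dL$ for all bounded continuous $f:D\to\mathbb R$; $X_n$ is *relatively compact* if every subsequence has a further subsequence that converges weakly to a tight Borel probability law; - $X_n$ is *asymptotically measurable* if $E^*[f(X_n)]-E_*[f(X_n)]\to0$ for all bounded continuous $f:D\to\mathbb R$; - $X_n\leftrightarrow_d Y_n$ (*relative weak convergence*) if $|E^*[f(X_n)]-E^*[f(Y_n)]|\to0$ for all bounded continuous $f:D\to\mathbb R$. Let $\mathbb X_n$ be a random variable with values in a measurable space $\mathcal X_n$, defined on a probability space $(\Omega_n,P_n)$, and $\mathbb V_n$ a random variable with values in a measurable space $\mathcal V_n$, defined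 on a probability space $(\Omega_n',Q_n)$. As usual for non-measurable maps, independence is understood through product spaces: on $\Omega_n\times\Omega_n'\times\Omega_n'$ with the measure $P_n\otimes Q_n\otimes Q_n$, the data are $\mathbb X_n(\omega)$ and the two independent copies of $\mathbb V_n$, independent of $\mathbb X_n$, are $\mathbb V_n^{(1)}=\mathbb V_n(\omega_1)$ and $\mathbb V_n^{(2)}=\mathbb V_n(\omega_2)$ at the point $(\omega,\omega_1,\omega_2)$. Let $\mathbb G_n=\mathbb G_n(\mathbb X_n)$ and $\mathbb G_n^{(j)}=\mathbb G_n^{b}(\mathbb X_n,\mathbb V_n^{(j)})$, $j=1,2$, be maps with values in $\ell^\infty(T)$ constructed from $\mathbb X_n$ and from $(\mathbb X_n,\mathbb V_n^{(j)})$, such that $\mathbb G_n(t)$ and $\mathbb G_n^{(j)}(t)$ are measurable for each $t\in T$. Let $\mathbb G_n^{\otimes 3}$ be the map $(\omega,\omega',\omega'')\mapsto(\mathbb G_n(\omega),\mathbb G_n(\omega'),\mathbb G_n(\omega''))$ on $\Omega_n^3$ with the measure $P_n^{\otimes3}$, that is, three independent copies of $\mathbb G_n$. Let $\mathrm{BL}_1$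 be the set of functions $h:\ell^\infty(T)\to\mathbb R$ with $|h|\le1$ and $|h(x)-h(y)|\le\|x-y\|$ for all $x,y$, and let $E^*[h(\mathbb G_n^{(1)})\mid\mathbb X_n]$ denote the outer expectation with respect to $\omega_1$ (under $Q_n$) for fixed $\omega$. **Proposition.** Assume that $\mathbb G_n$ is relatively compact. Then the following are equivalent: (a) as $n\to\infty$, $$\sup_{h\in\mathrm{BL}_1}\bigl|E^*[h(\mathbb G_n^{(1)})\mid\mathbb X_n]-E^*[h(\mathbb G_n)]\bigr|\to0\quad\text{in outer probability,}$$ and $\mathbb G_n^{(1)}$ is asymptotically measurable; (b) $(\mathbb G_n,\mathbb G_n^{(1)},\mathbb G_n^{(2)})\leftrightarrow_d\mathbb G_n^{\otimes3}$ in $\ell^\infty(T)^3$. -/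

import Mathlib

open MeasureTheory Filter Topology
open scoped BoundedContinuousFunction

noncomputable section

/-- The space `ℓ^∞(T)` of bounded real functions on `T`, with the supremum norm. -/
abbrev LInf (T : Type*) : Type _ := lp (fun _ : T => ℝ) (⊤ : ENNReal)

/-- `ℓ^∞(T)` carries its Borel `σ`-algebra. -/
instance LInf.instMeasurableSpace (T : Type*) : MeasurableSpace (LInf T) := borel _

instance LInf.instBorelSpace (T : Type*) : BorelSpace (LInf T) := ⟨rfl⟩

/-- Outer expectation `E^*[f]` of a bounded, not necessarily measurable, function `f` on a
probability space: the infimum of `E[U]` over all measurable integrable `U ≥ f`. -/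
def outerExp {Ω : Type*} [MeasurableSpace Ω] (P : Measure Ω) (f : Ω → ℝ) : ℝ :=
  sInf {c : ℝ | ∃ U : Ω → ℝ, Measurable U ∧ Integrable U P ∧ (∀ ω, f ω ≤ U ω) ∧ c = ∫ ω, U ω ∂P}

/-- Inner expectation `E_*[f] = -E^*[-f]`. -/
def innerExp {Ω : Type*} [MeasurableSpace Ω] (P : Measure Ω) (f : Ω → ℝ) : ℝ :=
  -outerExp P (fun ω => -f ω)

/-- Weak convergence (in the sense of Hoffmann-Jørgensen) of a sequence of arbitrary maps
`X n : Ω n → D` to the Borel law `L`. -/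
def WeaklyConverges {D : Type*} [TopologicalSpace D] [MeasurableSpace D]
    {Ω : ℕ → Type*} [∀ n, MeasurableSpace (Ω n)]
    (P : ∀ n, Measure (Ω n)) (X : ∀ n, Ω n → D) (L : Measure D) : Prop :=
  ∀ f : D →ᵇ ℝ, Tendsto (fun n => outerExp (P n) (fun ω => f (X n ω))) atTop (𝓝 (∫ x, f x ∂L))

/-- `X n` is relatively compact: every subsequence has a further subsequence that converges
weakly to a tight Borel probability law. -/
def RelativelyCompact {D : Type*} [TopologicalSpace D] [MeasurableSpace D]
    {Ω : ℕ → Type*} [∀ n, MeasurableSpace (Ω n)]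
    (P : ∀ n, Measure (Ω n)) (X : ∀ n, Ω n → D) : Prop :=
  ∀ φ : ℕ → ℕ, StrictMono φ → ∃ ψ : ℕ → ℕ, StrictMono ψ ∧
    ∃ L : Measure D, IsProbabilityMeasure L ∧ IsTightMeasureSet {L} ∧
      WeaklyConverges (fun k => P (φ (ψ k))) (fun k => X (φ (ψ k))) L

/-- `X n` is asymptotically measurable. -/
def AsymptoticallyMeasurable {D : Type*} [TopologicalSpace D]
    {Ω : ℕ → Type*} [∀ n, MeasurableSpace (Ω n)]
    (P : ∀ n, Measure (Ω n)) (X : ∀ n, Ω n → D) : Prop :=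
  ∀ f : D →ᵇ ℝ, Tendsto
    (fun n => outerExp (P n) (fun ω => f (X n ω)) - innerExp (P n) (fun ω => f (X n ω)))
    atTop (𝓝 0)

/-- `X n` and `Y n` are relatively weakly convergent, `X n ↔_d Y n`. -/
def RelativelyWeaklyConvergent {D : Type*} [TopologicalSpace D]
    {Ω Ω' : ℕ → Type*} [∀ n, MeasurableSpace (Ω n)] [∀ n, MeasurableSpace (Ω' n)]
    (P : ∀ n, Measure (Ω n)) (X : ∀ n, Ω n → D)
    (Q : ∀ n, Measure (Ω' n)) (Y : ∀ n, Ω' n → D) : Prop :=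
  ∀ f : D →ᵇ ℝ, Tendsto
    (fun n => |outerExp (P n) (fun ω => f (X n ω)) - outerExp (Q n) (fun ω => f (Y n ω))|)
    atTop (𝓝 0)

/-- `BL_1(D)`: the functions `D → ℝ` that are `1`-Lipschitz and bounded by `1`. -/
def BL1 (D : Type*) [PseudoMetricSpace D] : Set (D → ℝ) :=
  {h | LipschitzWith 1 h ∧ ∀ x, |h x| ≤ 1}

/-- The bounded-Lipschitz distance `sup_{h ∈ BL_1(D)} |E^*[h(X)] - E^*[h(Y)]|` of two arbitrary
maps into `D`; all the terms are at most `2` when `P` and `Q` are probability measures. -/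
def boundedLipschitzDist {D : Type*} [PseudoMetricSpace D]
    {Ω Ω' : Type*} [MeasurableSpace Ω] [MeasurableSpace Ω']
    (P : Measure Ω) (X : Ω → D) (Q : Measure Ω') (Y : Ω' → D) : ℝ :=
  ⨆ h : BL1 D, |outerExp P (fun ω => h.1 (X ω)) - outerExp Q (fun ω => h.1 (Y ω))|

/-- Convergence to `0` in outer probability of arbitrary real maps `Z n : Ω n → ℝ` (the value of a
`Measure` on an arbitrary set is its outer measure). -/
def TendstoZeroInOuterProb {Ω : ℕ → Type*} [∀ n, MeasurableSpace (Ω n)]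
    (P : ∀ n, Measure (Ω n)) (Z : ∀ n, Ω n → ℝ) : Prop :=
  ∀ ε : ℝ, 0 < ε → Tendsto (fun n => P n {ω | ε < |Z n ω|}) atTop (𝓝 0)

end

/-! By relative compactness it is enough to argue along subsequences on which `G n` converges weakly
to a tight law `L`. Both conditions are then compared with an intermediate one, `CondMeanTendsto`:
for a test function `h`, the variables `h (Gb n)` have measurable approximations with error
vanishing in mean, and their conditional means given the data converge in `L¹` to `∫ h ∂L`.

From (a) this follows for Lipschitz `h` by rescaling into `BL1`. From (b) it follows for every
continuous `h` bounded by 1 by a second moment argument: the middle marginal shows that `Gb n`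
converges weakly to `L`, and the test function `h y₂ * h y₃` shows that the conditional mean `V`
satisfies `E[V²] → (∫ h ∂L)²`. As also `E[V] → ∫ h ∂L`, it follows that `E[(V - ∫ h ∂L)²] → 0`.

For the way back, tightness gives a compact set carrying almost all of `L` and a finite Lipschitz
partition of unity `φ` around it. A continuous function on `D³` is nearly a combination of products
of the `φ a`, whose means factorise in the limit by conditional independence; this gives (b). All `h
∈ BL1` are nearly combinations of the same finitely many `φ a`, so the convergence of conditional
means is uniform in `h`; this gives (a).

Non-measurability is handled throughout by a pair `u`, `e` of measurable functions with `|f - u| ≤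
e`. Asymptotic measurability says exactly that `e` can be chosen with vanishing mean. -/

/-! ### Outer expectation and measurable approximation. -/

section OuterExpectation

variable {Ω : Type*} [MeasurableSpace Ω] {P : Measure Ω}

lemma integrable_of_abs_le [IsFiniteMeasure P] {u : Ω → ℝ} {M : ℝ} (hu : Measurable u)
    (hM : ∀ ω, |u ω| ≤ M) : Integrable u P :=
  Integrable.of_bound hu.aestronglyMeasurable M (.of_forall hM)

/-- A measurable approximation of `f` with measurable error bound controls `E^*[f]`. -/
lemma abs_outerExp_sub_integral_le {f u e : Ω → ℝ} (hu : Measurable u) (he : Measurable e)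
    (hui : Integrable u P) (hei : Integrable e P) (h : ∀ ω, |f ω - u ω| ≤ e ω) :
    |outerExp P f - ∫ ω, u ω ∂P| ≤ ∫ ω, e ω ∂P := by
  have hmem : (∫ ω, (u ω + e ω) ∂P) ∈ {c : ℝ | ∃ U : Ω → ℝ, Measurable U ∧ Integrable U P ∧
      (∀ ω, f ω ≤ U ω) ∧ c = ∫ ω, U ω ∂P} :=
    ⟨fun ω => u ω + e ω, hu.add he, hui.add hei,
      fun ω => by linarith [(abs_le.1 (h ω)).2], rfl⟩
  have hlow : ∀ c ∈ {c : ℝ | ∃ U : Ω → ℝ, Measurable U ∧ Integrable U P ∧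
      (∀ ω, f ω ≤ U ω) ∧ c = ∫ ω, U ω ∂P}, (∫ ω, u ω ∂P) - ∫ ω, e ω ∂P ≤ c := by
    rintro c ⟨U, -, hUi, hfU, rfl⟩
    rw [← integral_sub hui hei]
    exact integral_mono (hui.sub hei) hUi
      fun ω => by linarith [(abs_le.1 (h ω)).1, hfU ω]
  have h1 := csInf_le ⟨_, hlow⟩ hmem
  have h2 := le_csInf ⟨_, hmem⟩ hlow
  rw [integral_add hui hei] at h1
  rw [abs_le]
  constructor <;> simp only [outerExp] <;> linarith

/-- The infimum is attained: the countable infimum of a minimising sequence of majorants, truncated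
at `M`, is still a measurable majorant and its integral is below each of theirs. -/
lemma exists_measurable_majorant [IsProbabilityMeasure P] {f : Ω → ℝ} {M : ℝ}
    (hf : ∀ ω, |f ω| ≤ M) :
    ∃ u : Ω → ℝ, Measurable u ∧ (∀ ω, f ω ≤ u ω) ∧ (∀ ω, |u ω| ≤ M) ∧
      ∫ ω, u ω ∂P = outerExp P f := by
  set S := {c : ℝ | ∃ U : Ω → ℝ, Measurable U ∧ Integrable U P ∧ (∀ ω, f ω ≤ U ω) ∧
    c = ∫ ω, U ω ∂P} with hS
  have hne : S.Nonempty :=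
    ⟨_, fun _ => M, measurable_const, integrable_const _, fun ω => (abs_le.1 (hf ω)).2, rfl⟩
  have hbdd : BddBelow S := by
    refine ⟨-M, ?_⟩
    rintro c ⟨U, -, hUi, hfU, rfl⟩
    have := integral_mono (μ := P) (integrable_const (-M)) hUi
      fun ω => (abs_le.1 (hf ω)).1.trans (hfU ω)
    simpa using this
  obtain ⟨c, -, hc, hcS⟩ := exists_seq_tendsto_sInf hne hbdd
  choose U hUm hUi hfU hcU using hcS
  have hlow : ∀ ω k, f ω ≤ min (U k ω) M := fun ω k => le_min (hfU k ω) (abs_le.1 (hf ω)).2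
  have hb : ∀ ω, BddBelow (Set.range fun k => min (U k ω) M) := fun ω =>
    ⟨f ω, by rintro _ ⟨k, rfl⟩; exact hlow ω k⟩
  have hum : Measurable fun ω => ⨅ k, min (U k ω) M :=
    Measurable.iInf fun k => (hUm k).min measurable_const
  have hfu : ∀ ω, f ω ≤ ⨅ k, min (U k ω) M := fun ω => le_ciInf (hlow ω)
  have huM : ∀ ω, |⨅ k, min (U k ω) M| ≤ M := fun ω => abs_le.2
    ⟨(abs_le.1 (hf ω)).1.trans (hfu ω), (ciInf_le (hb ω) 0).trans (min_le_right _ _)⟩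
  have hui := integrable_of_abs_le (P := P) hum huM
  refine ⟨_, hum, hfu, huM, le_antisymm ?_ (csInf_le hbdd ⟨_, hum, hui, hfu, rfl⟩)⟩
  refine ge_of_tendsto' hc fun k => ?_
  rw [hcU k]
  exact integral_mono hui (hUi k) fun ω => (ciInf_le (hb ω) k).trans (min_le_left _ _)

/-- A bounded function is approximated by a measurable one, up to a measurable error whose mean is
the gap between outer and inner expectation. -/
lemma exists_measurable_approx [IsProbabilityMeasure P] {f : Ω → ℝ} {M : ℝ}
    (hf : ∀ ω, |f ω| ≤ M) :
    ∃ u e : Ω → ℝ, Measurable u ∧ Measurable e ∧ (∀ ω, |u ω| ≤ M) ∧ (∀ ω, e ω ≤ 2 * M) ∧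
      (∀ ω, |f ω - u ω| ≤ e ω) ∧ ∫ ω, u ω ∂P = outerExp P f ∧
      ∫ ω, e ω ∂P = outerExp P f - innerExp P f := by
  obtain ⟨u, hu, hfu, huM, hui⟩ := exists_measurable_majorant (P := P) hf
  -- A majorant `l` of `-f` makes `-l` a minorant of `f`, so `u + l` is the width of a measurable
  -- bracket around `f`.
  obtain ⟨l, hl, hfl, hlM, hli⟩ := exists_measurable_majorant (P := P) (f := fun ω => -f ω)
    (M := M) fun ω => by simpa using hf ω
  refine ⟨u, fun ω => u ω + l ω, hu, hu.add hl, huM, fun ω => ?_, fun ω => ?_, hui, ?_⟩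
  · linarith [(abs_le.1 (huM ω)).2, (abs_le.1 (hlM ω)).2]
  · rw [abs_le]; constructor <;> linarith [hfu ω, hfl ω]
  · rw [integral_add (integrable_of_abs_le hu huM) (integrable_of_abs_le hl hlM), hui, hli,
      innerExp, sub_neg_eq_add]

lemma abs_outerExp_le [IsProbabilityMeasure P] {f : Ω → ℝ} {M : ℝ} (hf : ∀ ω, |f ω| ≤ M) :
    |outerExp P f| ≤ M := by
  have := abs_outerExp_sub_integral_le (P := P) (f := f) (u := fun _ => 0) (e := fun _ => M)
    measurable_const measurable_const (integrable_const _) (integrable_const _)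
    (by simpa using hf)
  simpa using this

/-- Outer expectation does not increase under composition with a measure preserving map. -/
lemma outerExp_comp_le [IsProbabilityMeasure P] {Ω' : Type*} [MeasurableSpace Ω']
    {Q : Measure Ω'} [IsProbabilityMeasure Q] {π : Ω → Ω'} (hπ : MeasurePreserving π P Q)
    {f : Ω' → ℝ} {M : ℝ} (hf : ∀ ω, |f ω| ≤ M) :
    outerExp P (fun ω => f (π ω)) ≤ outerExp Q f := by
  obtain ⟨u, hu, hfu, huM, hui⟩ := exists_measurable_majorant (P := Q) hf
  rw [← hui, ← hπ.map_eq, integral_map hπ.measurable.aemeasurable hu.aestronglyMeasurable]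
  refine csInf_le ⟨-M, ?_⟩ ⟨_, hu.comp hπ.measurable,
    integrable_of_abs_le (hu.comp hπ.measurable) (fun ω => huM (π ω)), fun ω => hfu _, rfl⟩
  rintro c ⟨U, -, hUi, hfU, rfl⟩
  have := integral_mono (μ := P) (integrable_const (-M)) hUi
    fun ω => (abs_le.1 (hf (π ω))).1.trans (hfU ω)
  simpa using this

/-- A coordinate projection of a product of probability spaces is perfect. -/
lemma outerExp_le_outerExp_fst [IsProbabilityMeasure P] {Ω' : Type*} [MeasurableSpace Ω']
    {Q : Measure Ω'} [IsProbabilityMeasure Q] {f : Ω → ℝ} {M : ℝ} (hf : ∀ ω, |f ω| ≤ M) :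
    outerExp P f ≤ outerExp (P.prod Q) (fun p => f p.1) := by
  obtain ⟨u, hu, hfu, huM, hui⟩ := exists_measurable_majorant (P := P.prod Q)
    (f := fun p => f p.1) fun p => hf p.1
  have hsec : ∀ ω, Integrable (fun ω' => u (ω, ω')) Q := fun ω =>
    integrable_of_abs_le (hu.comp measurable_prodMk_left) fun ω' => huM _
  have hi := integrable_of_abs_le (P := P.prod Q) hu huM
  rw [← hui, integral_prod _ hi]
  -- Integrating out the second coordinate of a majorant of `f ∘ fst` leaves a majorant of `f` with
  -- the same mean.
  refine csInf_le ⟨-M, ?_⟩ ⟨_, hu.stronglyMeasurable.integral_prod_right'.measurable,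
    hi.integral_prod_left, fun ω => ?_, rfl⟩
  · rintro c ⟨U, -, hUi, hfU, rfl⟩
    have := integral_mono (μ := P) (integrable_const (-M)) hUi
      fun ω => (abs_le.1 (hf ω)).1.trans (hfU ω)
    simpa using this
  · have := integral_mono (μ := Q) (integrable_const (f ω)) (hsec ω) fun ω' => hfu (ω, ω')
    simpa using this

lemma innerExp_le_outerExp [IsProbabilityMeasure P] {f : Ω → ℝ} {M : ℝ} (hf : ∀ ω, |f ω| ≤ M) :
    innerExp P f ≤ outerExp P f := by
  obtain ⟨u, e, -, -, -, -, hue, -, he⟩ := exists_measurable_approx (P := P) hf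
  have : 0 ≤ ∫ ω, e ω ∂P := integral_nonneg fun ω => (abs_nonneg _).trans (hue ω)
  linarith

lemma le_boundedLipschitzDist [IsProbabilityMeasure P] {Ω' D : Type*} [MeasurableSpace Ω']
    {Q : Measure Ω'} [IsProbabilityMeasure Q] [PseudoMetricSpace D] {X : Ω → D} {Y : Ω' → D}
    {h : D → ℝ} (hh : h ∈ BL1 D) :
    |outerExp P (fun ω => h (X ω)) - outerExp Q (fun ω => h (Y ω))|
      ≤ boundedLipschitzDist P X Q Y := by
  -- A real supremum dominates its terms only if the family is bounded above; here 2 is a bound.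
  refine le_ciSup (f := fun h : BL1 D =>
    |outerExp P (fun ω => h.1 (X ω)) - outerExp Q (fun ω => h.1 (Y ω))|) ⟨2, ?_⟩ ⟨h, hh⟩
  rintro _ ⟨g, rfl⟩
  have h1 := abs_outerExp_le (P := P) (f := fun ω => g.1 (X ω)) fun ω => g.2.2 _
  have h2 := abs_outerExp_le (P := Q) (f := fun ω => g.1 (Y ω)) fun ω => g.2.2 _
  refine (abs_sub _ _).trans ?_
  linarith

end OuterExpectation

/-! ### Finite Lipschitz partitions of unity. -/

/-- Splitting `t` as `t * ∑ w + t * (1 - ∑ w)`, the covered part costs `ε` and the missing weight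
costs at most `M` times itself. -/
lemma abs_sub_sum_mul_le {ι : Type*} [Fintype ι] {w c : ι → ℝ} {t ε M : ℝ} (hε : 0 ≤ ε)
    (hw : ∀ i, 0 ≤ w i) (hw1 : ∑ i, w i ≤ 1) (hc : ∀ i, w i ≠ 0 → |t - c i| ≤ ε) (ht : |t| ≤ M) :
    |t - ∑ i, c i * w i| ≤ ε + M * (1 - ∑ i, w i) := by
  have h1 : t - ∑ i, c i * w i = ∑ i, (t - c i) * w i + t * (1 - ∑ i, w i) := by
    simp only [sub_mul, Finset.sum_sub_distrib, ← Finset.mul_sum]; ring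
  have h2 : |∑ i, (t - c i) * w i| ≤ ∑ i, ε * w i := by
    refine (Finset.abs_sum_le_sum_abs _ _).trans (Finset.sum_le_sum fun i _ => ?_)
    rw [abs_mul, abs_of_nonneg (hw i)]
    by_cases h : w i = 0
    · simp [h]
    · exact mul_le_mul_of_nonneg_right (hc i h) (hw i)
  rw [← Finset.mul_sum] at h2
  have h3 : |t * (1 - ∑ i, w i)| ≤ M * (1 - ∑ i, w i) := by
    rw [abs_mul, abs_of_nonneg (sub_nonneg.2 hw1)]
    exact mul_le_mul_of_nonneg_right ht (sub_nonneg.2 hw1)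
  rw [h1]
  refine (abs_add_le _ _).trans ?_
  nlinarith

/-- A finite Lipschitz partition of unity around a compact set, subordinate to `δ`-balls centred at
points of that set. -/
lemma exists_lipschitz_partition {D : Type*} [PseudoMetricSpace D] {K : Set D} (hK : IsCompact K)
    {δ : ℝ} (hδ : 0 < δ) :
    ∃ (s : Finset D) (φ : s → D →ᵇ ℝ), (∀ a : s, (a : D) ∈ K) ∧ (∀ a y, 0 ≤ φ a y) ∧
      (∀ y, ∑ a, φ a y ≤ 1) ∧ (∀ y ∈ K, ∑ a, φ a y = 1) ∧
      (∀ a y, φ a y ≠ 0 → dist (a : D) y < δ) ∧ ∀ a, ∃ C, LipschitzWith C (φ a) := by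
  obtain ⟨t, htK, htf, hcov⟩ := hK.finite_cover_balls (half_pos hδ)
  lift t to Finset D using htf
  -- Tent functions over a `δ / 2`-net of `K`. On `K` their sum is at least `δ / 2`, so the
  -- normaliser `σ` equals the sum there; off `K` the floor `δ / 2` keeps the quotients globally
  -- Lipschitz.
  let b : t → D → ℝ := fun a y => max 0 (δ - dist (a : D) y)
  let σ : D → ℝ := fun y => max (δ / 2) (∑ a, b a y)
  have hb0 : ∀ a y, 0 ≤ b a y := fun a y => le_max_left _ _
  have hσ : ∀ y, δ / 2 ≤ σ y := fun y => le_max_left _ _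
  have hσ0 : ∀ y, 0 < σ y := fun y => (half_pos hδ).trans_le (hσ y)
  have hbσ : ∀ a y, b a y ≤ σ y := fun a y =>
    (Finset.single_le_sum (fun i _ => hb0 i y) (Finset.mem_univ a)).trans (le_max_right _ _)
  have hbl : ∀ a y z, |b a y - b a z| ≤ dist y z := by
    intro a y z
    have h1 : |b a y - b a z| ≤ |(δ - dist (a : D) y) - (δ - dist (a : D) z)| := by
      simp only [b]
      rw [max_comm 0, max_comm 0]
      exact abs_max_sub_max_le_abs _ _ _
    refine h1.trans ?_
    rw [sub_sub_sub_cancel_left, abs_sub_comm, dist_comm _ y, dist_comm _ z]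
    exact abs_dist_sub_le _ _ _
  have hσl : ∀ y z, |σ y - σ z| ≤ t.card * dist y z := by
    intro y z
    have h1 : |σ y - σ z| ≤ |∑ a, b a y - ∑ a, b a z| := by
      simp only [σ]
      rw [max_comm (δ / 2), max_comm (δ / 2)]
      exact abs_max_sub_max_le_abs _ _ _
    refine h1.trans ?_
    rw [← Finset.sum_sub_distrib]
    refine (Finset.abs_sum_le_sum_abs _ _).trans ?_
    refine (Finset.sum_le_sum fun a _ => hbl a y z).trans ?_
    simp
  have hlip : ∀ a, LipschitzWith (Real.toNNReal ((1 + t.card) / (δ / 2)))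
      (fun y => b a y / σ y) := by
    intro a
    refine LipschitzWith.of_dist_le_mul fun y z => ?_
    rw [Real.coe_toNNReal _ (by positivity), Real.dist_eq]
    have hy := (hσ0 y).ne'
    have hz := (hσ0 z).ne'
    have h1 : b a y / σ y - b a z / σ z
        = ((b a y - b a z) + b a z / σ z * (σ z - σ y)) / σ y := by
      field_simp
      ring
    have h2 : |b a z / σ z * (σ z - σ y)| ≤ t.card * dist y z := by
      rw [abs_mul, abs_of_nonneg (div_nonneg (hb0 a z) (hσ0 z).le), abs_sub_comm]
      exact (mul_le_of_le_one_left (abs_nonneg _) ((div_le_one (hσ0 z)).2 (hbσ a z))).trans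
        (hσl y z)
    rw [h1, abs_div, abs_of_pos (hσ0 y), div_mul_eq_mul_div (1 + (t.card : ℝ))]
    refine div_le_div₀ (by positivity) ?_ (half_pos hδ) (hσ y)
    linarith [abs_add_le (b a y - b a z) (b a z / σ z * (σ z - σ y)), hbl a y z]
  have hφ0 : ∀ a y, 0 ≤ b a y / σ y := fun a y => div_nonneg (hb0 a y) (hσ0 y).le
  refine ⟨t, fun a => BoundedContinuousFunction.ofNormedAddCommGroup (fun y => b a y / σ y)
    (hlip a).continuous 1 fun y => ?_, fun a => htK a.2, hφ0, fun y => ?_, fun y hy => ?_,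
    fun a y h => ?_, fun a => ⟨_, hlip a⟩⟩
  · rw [Real.norm_eq_abs, abs_of_nonneg (hφ0 a y)]
    exact (div_le_one (hσ0 y)).2 (hbσ a y)
  · simp only [BoundedContinuousFunction.coe_ofNormedAddCommGroup]
    rw [← Finset.sum_div, div_le_one (hσ0 y)]
    exact le_max_right _ _
  · simp only [BoundedContinuousFunction.coe_ofNormedAddCommGroup]
    rw [← Finset.sum_div, div_eq_one_iff_eq (hσ0 y).ne']
    symm
    refine max_eq_right ?_
    obtain ⟨x, hx, hxy⟩ := Set.mem_iUnion₂.1 (hcov hy)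
    refine le_trans ?_ (Finset.single_le_sum (fun i _ => hb0 i y) (Finset.mem_univ ⟨x, hx⟩))
    refine le_trans ?_ (le_max_right _ _)
    have := Metric.mem_ball'.1 hxy
    simp only
    linarith
  · by_contra hcon
    refine h ?_
    have : b a y = 0 := max_eq_left (by linarith)
    simp [this]

/-! ### Limits of integrals and asymptotic measurability. -/

section IntegralLimits

variable {A : ℕ → Type*} [∀ n, MeasurableSpace (A n)] {μ : ∀ n, Measure (A n)}

/-- A sequence of measurable integrable functions whose integrals converge to `c`. -/
structure IntegralTendsto (μ : ∀ n, Measure (A n)) (F : ∀ n, A n → ℝ) (c : ℝ) : Prop where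
  measurable : ∀ n, Measurable (F n)
  integrable : ∀ n, Integrable (F n) (μ n)
  tendsto : Tendsto (fun n => ∫ x, F n x ∂μ n) atTop (𝓝 c)

namespace IntegralTendsto

variable {F F' : ∀ n, A n → ℝ} {c c' : ℝ}

lemma const [∀ n, IsProbabilityMeasure (μ n)] {r : ℕ → ℝ} (hr : Tendsto r atTop (𝓝 c)) :
    IntegralTendsto μ (fun n _ => r n) c :=
  ⟨fun _ => measurable_const, fun _ => integrable_const _, by simpa using hr⟩

lemma add (h : IntegralTendsto μ F c) (h' : IntegralTendsto μ F' c') :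
    IntegralTendsto μ (fun n x => F n x + F' n x) (c + c') :=
  ⟨fun n => (h.measurable n).add (h'.measurable n),
    fun n => (h.integrable n).add (h'.integrable n), by
      simpa only [integral_add (h.integrable _) (h'.integrable _)] using h.tendsto.add h'.tendsto⟩

lemma sub (h : IntegralTendsto μ F c) (h' : IntegralTendsto μ F' c') :
    IntegralTendsto μ (fun n x => F n x - F' n x) (c - c') :=
  ⟨fun n => (h.measurable n).sub (h'.measurable n),
    fun n => (h.integrable n).sub (h'.integrable n), by
      simpa only [integral_sub (h.integrable _) (h'.integrable _)] using h.tendsto.sub h'.tendsto⟩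

lemma const_mul (h : IntegralTendsto μ F c) (r : ℝ) :
    IntegralTendsto μ (fun n x => r * F n x) (r * c) :=
  ⟨fun n => (h.measurable n).const_mul r, fun n => (h.integrable n).const_mul r, by
      simpa only [integral_const_mul] using h.tendsto.const_mul r⟩

lemma sum {ι : Type*} [Fintype ι] {F : ι → ∀ n, A n → ℝ} {c : ι → ℝ}
    (h : ∀ i, IntegralTendsto μ (F i) (c i)) :
    IntegralTendsto μ (fun n x => ∑ i, F i n x) (∑ i, c i) :=
  ⟨fun n => Finset.measurable_fun_sum _ fun i _ => (h i).measurable n,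
    fun n => integrable_finsetSum _ fun i _ => (h i).integrable n, by
      simp only [integral_finsetSum _ fun i _ => (h i).integrable _]
      exact tendsto_finsetSum _ fun i _ => (h i).tendsto⟩

lemma comp (h : IntegralTendsto μ F c) {B : ℕ → Type*} [∀ n, MeasurableSpace (B n)]
    {ν : ∀ n, Measure (B n)} {π : ∀ n, B n → A n} (hπ : ∀ n, MeasurePreserving (π n) (ν n) (μ n)) :
    IntegralTendsto ν (fun n x => F n (π n x)) c := by
  refine ⟨fun n => (h.measurable n).comp (hπ n).measurable,
    fun n => (hπ n).integrable_comp_of_integrable (h.integrable n), ?_⟩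
  refine h.tendsto.congr fun n => ?_
  rw [← (hπ n).map_eq, integral_map (hπ n).measurable.aemeasurable
    (h.measurable n).aestronglyMeasurable]

lemma congr_limit (h : IntegralTendsto μ F c) (hc : c = c') : IntegralTendsto μ F c' := hc ▸ h

lemma eventually_outerExp_le (h : IntegralTendsto μ F c) (h' : IntegralTendsto μ F' c')
    {f : ∀ n, A n → ℝ} (hf : ∀ n x, |f n x - F n x| ≤ F' n x) {η : ℝ} (hη : 0 < η) :
    ∀ᶠ n in atTop, |outerExp (μ n) (f n) - c| ≤ c' + η := by
  have h1 := Metric.tendsto_nhds.1 h.tendsto (η / 2) (half_pos hη)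
  have h2 := Metric.tendsto_nhds.1 h'.tendsto (η / 2) (half_pos hη)
  filter_upwards [h1, h2] with n h1 h2
  have h3 := abs_outerExp_sub_integral_le (h.measurable n) (h'.measurable n) (h.integrable n)
    (h'.integrable n) (hf n)
  rw [Real.dist_eq] at h1 h2
  have h4 := abs_sub_le (outerExp (μ n) (f n)) (∫ x, F n x ∂μ n) c
  linarith [(abs_lt.1 h2).2]

lemma tendsto_outerExp (h : IntegralTendsto μ F c) (h' : IntegralTendsto μ F' 0)
    {f : ∀ n, A n → ℝ} (hf : ∀ n x, |f n x - F n x| ≤ F' n x) :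
    Tendsto (fun n => outerExp (μ n) (f n)) atTop (𝓝 c) := by
  refine Metric.tendsto_nhds.2 fun η hη => ?_
  filter_upwards [h.eventually_outerExp_le h' hf (half_pos hη)] with n hn
  rw [Real.dist_eq]
  linarith

lemma squeeze [∀ n, IsFiniteMeasure (μ n)] (h : IntegralTendsto μ F 0) {W : ∀ n, A n → ℝ}
    (hW : ∀ n, Measurable (W n)) (hWF : ∀ n x, |W n x| ≤ F n x) : IntegralTendsto μ W 0 := by
  have hi : ∀ n, Integrable (W n) (μ n) := fun n =>
    (h.integrable n).mono' (hW n).aestronglyMeasurable (.of_forall (hWF n))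
  refine ⟨hW, hi, squeeze_zero_norm (fun n => ?_) h.tendsto⟩
  refine (norm_integral_le_integral_norm _).trans (integral_mono (hi n).norm (h.integrable n) ?_)
  exact hWF n

end IntegralTendsto

lemma abs_integral_le_of_abs_le {Ω : Type*} [MeasurableSpace Ω] {P : Measure Ω}
    [IsProbabilityMeasure P] {f : Ω → ℝ} {M : ℝ} (hf : ∀ ω, |f ω| ≤ M) :
    |∫ ω, f ω ∂P| ≤ M := by
  simpa using norm_integral_le_of_norm_le_const (μ := P) (f := f)
    (.of_forall fun ω => (Real.norm_eq_abs _).trans_le (hf ω))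

/-- `u` is a measurable approximation of `f : A → [-1, 1]` with measurable error bound `e`. -/
structure MeasApprox {A : Type*} [MeasurableSpace A] (f u e : A → ℝ) : Prop where
  measurable : Measurable u
  measurable_err : Measurable e
  abs_le : ∀ x, |u x| ≤ 1
  err_le : ∀ x, |e x| ≤ 2
  abs_sub_le : ∀ x, |f x - u x| ≤ e x

lemma MeasApprox.err_nonneg {A : Type*} [MeasurableSpace A] {f u e : A → ℝ}
    (h : MeasApprox f u e) (x : A) : 0 ≤ e x := (abs_nonneg _).trans (h.abs_sub_le x)

variable {D : Type*} [TopologicalSpace D] {X : ∀ n, A n → D}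

lemma AsymptoticallyMeasurable.exists_measApprox [∀ n, IsProbabilityMeasure (μ n)]
    (hX : AsymptoticallyMeasurable μ X) {h : D →ᵇ ℝ} (hh : ∀ y, |h y| ≤ 1) :
    ∃ u e : ∀ n, A n → ℝ, (∀ n, MeasApprox (fun x => h (X n x)) (u n) (e n)) ∧
      IntegralTendsto μ e 0 ∧ ∀ n, ∫ x, u n x ∂μ n = outerExp (μ n) (fun x => h (X n x)) := by
  choose u e hu he hu1 he2 hue hui hei using fun n =>
    exists_measurable_approx (P := μ n) (f := fun x => h (X n x)) fun x => hh _
  have he2' : ∀ n x, |e n x| ≤ 2 := fun n x => by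
    rw [abs_of_nonneg ((abs_nonneg _).trans (hue n x))]; linarith [he2 n x]
  refine ⟨u, e, fun n => ⟨hu n, he n, hu1 n, he2' n, hue n⟩,
    ⟨he, fun n => integrable_of_abs_le (he n) (he2' n), ?_⟩, hui⟩
  simpa only [hei] using hX h

variable [MeasurableSpace D] {L : Measure D}

lemma WeaklyConverges.tendsto_innerExp (hX : WeaklyConverges μ X L) (f : D →ᵇ ℝ) :
    Tendsto (fun n => innerExp (μ n) (fun x => f (X n x))) atTop (𝓝 (∫ x, f x ∂L)) := by
  have := (hX (-f)).neg
  simpa [innerExp, integral_neg] using this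

lemma WeaklyConverges.asymptoticallyMeasurable (hX : WeaklyConverges μ X L) :
    AsymptoticallyMeasurable μ X := fun f => by
  simpa using (hX f).sub (hX.tendsto_innerExp f)

/-- Weak convergence of `X n` makes `h (X n)` asymptotically measurable, with converging means. -/
lemma WeaklyConverges.exists_measApprox [∀ n, IsProbabilityMeasure (μ n)]
    (hX : WeaklyConverges μ X L) {h : D →ᵇ ℝ} (hh : ∀ y, |h y| ≤ 1) :
    ∃ u e : ∀ n, A n → ℝ, (∀ n, MeasApprox (fun x => h (X n x)) (u n) (e n)) ∧
      IntegralTendsto μ e 0 ∧ IntegralTendsto μ u (∫ x, h x ∂L) := by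
  obtain ⟨u, e, hue, he, hu⟩ := hX.asymptoticallyMeasurable.exists_measApprox hh
  exact ⟨u, e, hue, he, fun n => (hue n).measurable,
    fun n => integrable_of_abs_le (hue n).measurable (hue n).abs_le, by simpa only [hu] using hX h⟩

/-- Since `d` need not be measurable, the exceptional set is `{E + ε / 8 + r < W}`: it is measurable
and contained in `{ε / 8 < |d|}`. Off it `W` is bounded by terms of small mean, on it by 2. -/
lemma tendsto_integral_of_outerProb [∀ n, IsProbabilityMeasure (μ n)] {W E d : ∀ n, A n → ℝ}
    {r : ℕ → ℝ} (hE : IntegralTendsto μ E 0) (hE0 : ∀ n x, 0 ≤ E n x)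
    (hW : ∀ n, Measurable (W n)) (hW0 : ∀ n x, 0 ≤ W n x) (hW2 : ∀ n x, W n x ≤ 2)
    (hr : Tendsto r atTop (𝓝 0)) (hr0 : ∀ n, 0 ≤ r n) (hd : TendstoZeroInOuterProb μ d)
    (hWd : ∀ n x, W n x ≤ E n x + d n x + r n) : IntegralTendsto μ W 0 := by
  have hWa : ∀ n x, |W n x| ≤ 2 := fun n x => by rw [abs_of_nonneg (hW0 n x)]; exact hW2 n x
  have hWi : ∀ n, Integrable (W n) (μ n) := fun n => integrable_of_abs_le (hW n) (hWa n)
  refine ⟨hW, hWi, Metric.tendsto_nhds.2 fun ε hε => ?_⟩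
  have h4 : (0 : ℝ) < ε / 8 := by positivity
  have h1 := Metric.tendsto_nhds.1 hE.tendsto (ε / 8) h4
  have h2 := Metric.tendsto_nhds.1 hr (ε / 8) h4
  have h3 := (ENNReal.tendsto_nhds_zero.1 (hd (ε / 8) h4)) (ENNReal.ofReal (ε / 8)) (by simpa)
  filter_upwards [h1, h2, h3] with n h1 h2 h3
  set S : Set (A n) := {x | E n x + ε / 8 + r n < W n x} with hS
  have hSm : MeasurableSet S :=
    measurableSet_lt (((hE.measurable n).add_const _).add_const _) (hW n)
  have hSd : (μ n).real S ≤ ε / 8 := by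
    refine ENNReal.toReal_le_of_le_ofReal h4.le ((measure_mono fun x hx => ?_).trans h3)
    have h5 : E n x + ε / 8 + r n < W n x := hx
    exact (lt_of_lt_of_le (by linarith [hWd n x]) (le_abs_self _) : ε / 8 < |d n x|)
  have hle : ∀ x, W n x ≤ (E n x + (ε / 8 + r n)) + S.indicator (fun _ => 2) x := by
    intro x
    by_cases hx : x ∈ S
    · rw [Set.indicator_of_mem hx]
      linarith [hW2 n x, hE0 n x, hr0 n]
    · rw [Set.indicator_of_notMem hx]
      have : ¬ E n x + ε / 8 + r n < W n x := hx
      linarith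
  have hi1 : Integrable (fun x => E n x + (ε / 8 + r n)) (μ n) :=
    (hE.integrable n).add (integrable_const _)
  have hi2 : Integrable (S.indicator fun _ => (2 : ℝ)) (μ n) :=
    (integrable_const _).indicator hSm
  have h6 := integral_mono (hWi n) (hi1.add hi2) hle
  have h7 : ∫ x, ((fun x => E n x + (ε / 8 + r n)) + S.indicator fun _ => (2 : ℝ)) x ∂μ n
      = ∫ x, E n x ∂μ n + (ε / 8 + r n) + (μ n).real S * 2 := by
    simp only [Pi.add_apply]
    rw [integral_add hi1 hi2, integral_add (hE.integrable n) (integrable_const _),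
      integral_indicator_const _ hSm]
    simp
  rw [h7] at h6
  rw [Real.dist_eq, sub_zero] at h1 h2 ⊢
  rw [abs_of_nonneg (integral_nonneg (hW0 n))]
  linarith [(abs_lt.1 h1).2, (abs_lt.1 h2).2]

end IntegralLimits

/-! ### Product spaces and conditional independence. -/

section Fubini

variable {Ω Ω' : Type*} [MeasurableSpace Ω] [MeasurableSpace Ω'] (P : Measure Ω) (Q : Measure Ω')
  [IsProbabilityMeasure P] [IsProbabilityMeasure Q]

lemma measurePreserving_prod_first :
    MeasurePreserving (fun p : Ω × Ω' × Ω' => (p.1, p.2.1)) (P.prod (Q.prod Q)) (P.prod Q) :=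
  (MeasurePreserving.id P).prod measurePreserving_fst

lemma measurePreserving_prod_second :
    MeasurePreserving (fun p : Ω × Ω' × Ω' => (p.1, p.2.2)) (P.prod (Q.prod Q)) (P.prod Q) :=
  (MeasurePreserving.id P).prod measurePreserving_snd

variable {P Q}

lemma measurable_integral_section {v : Ω × Ω' → ℝ} (hv : Measurable v) :
    Measurable fun ω => ∫ ω', v (ω, ω') ∂Q :=
  hv.stronglyMeasurable.integral_prod_right'.measurable

omit [MeasurableSpace Ω] in
lemma abs_integral_section_le {v : Ω × Ω' → ℝ} {M : ℝ} (hv : ∀ p, |v p| ≤ M) (ω : Ω) :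
    |∫ ω', v (ω, ω') ∂Q| ≤ M :=
  abs_integral_le_of_abs_le fun _ => hv _

/-- Conditional independence, given the first coordinate, of the two copies. -/
lemma integral_mul_mul_section {u : Ω → ℝ} {v w : Ω × Ω' → ℝ} (hu : Measurable u)
    (hv : Measurable v) (hw : Measurable w) (hu1 : ∀ ω, |u ω| ≤ 1) (hv1 : ∀ p, |v p| ≤ 1)
    (hw1 : ∀ p, |w p| ≤ 1) :
    ∫ p, u p.1 * (v (p.1, p.2.1) * w (p.1, p.2.2)) ∂(P.prod (Q.prod Q))
      = ∫ ω, u ω * ((∫ ω', v (ω, ω') ∂Q) * ∫ ω', w (ω, ω') ∂Q) ∂P := by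
  rw [integral_prod]
  · refine integral_congr_ae (.of_forall fun ω => ?_)
    simp only
    rw [integral_const_mul]
    congr 1
    exact integral_prod_mul (fun ω' => v (ω, ω')) fun ω' => w (ω, ω')
  · refine integrable_of_abs_le (M := 1) ?_ fun p => ?_
    · exact (hu.comp measurable_fst).mul
        ((hv.comp (measurePreserving_prod_first P Q).measurable).mul
          (hw.comp (measurePreserving_prod_second P Q).measurable))
    · rw [abs_mul, abs_mul]
      exact mul_le_one₀ (hu1 _) (by positivity) (mul_le_one₀ (hv1 _) (abs_nonneg _) (hw1 _))

end Fubini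

/-! ### Convergence of conditional means, from either condition. -/

section ConditionalLimits

variable {Ω Ω' : ℕ → Type*} [∀ n, MeasurableSpace (Ω n)] [∀ n, MeasurableSpace (Ω' n)]
  {P : ∀ n, Measure (Ω n)} [∀ n, IsProbabilityMeasure (P n)]
  {Q : ∀ n, Measure (Ω' n)} [∀ n, IsProbabilityMeasure (Q n)]

/-- The maps `Z n` have measurable approximations `v n` with vanishing mean error, whose conditional
means given the first coordinate converge to `c` in mean. -/
def CondMeanTendsto (P : ∀ n, Measure (Ω n)) (Q : ∀ n, Measure (Ω' n))
    (Z : ∀ n, Ω n × Ω' n → ℝ) (c : ℝ) : Prop :=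
  ∃ v e : ∀ n, Ω n × Ω' n → ℝ, (∀ n, MeasApprox (Z n) (v n) (e n)) ∧
    IntegralTendsto (fun n => (P n).prod (Q n)) e 0 ∧
    IntegralTendsto P (fun n ω => |∫ ω', v n (ω, ω') ∂Q n - c|) 0

lemma IntegralTendsto.integral_section {e : ∀ n, Ω n × Ω' n → ℝ} {c : ℝ}
    (he : IntegralTendsto (fun n => (P n).prod (Q n)) e c) :
    IntegralTendsto P (fun n ω => ∫ ω', e n (ω, ω') ∂Q n) c :=
  ⟨fun n => measurable_integral_section (he.measurable n),
    fun n => (he.integrable n).integral_prod_left, by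
      simpa only [integral_prod _ (he.integrable _)] using he.tendsto⟩

variable {D : Type*} [PseudoMetricSpace D] [MeasurableSpace D] {L : Measure D}
  [IsProbabilityMeasure L] {G : ∀ n, Ω n → D} {Gb : ∀ n, Ω n × Ω' n → D}

omit [IsProbabilityMeasure L] in
-- Independent copies of `G n` are themselves a bootstrap, with `Q = P` and no dependence on the
-- data. This lets one limit theorem treat both sides of the relative convergence.
lemma condMeanTendsto_snd (hG : WeaklyConverges P G L) {h : D →ᵇ ℝ} (hh : ∀ y, |h y| ≤ 1) :
    CondMeanTendsto P P (fun n p => h (G n p.2)) (∫ y, h y ∂L) := by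
  obtain ⟨u, e, hue, he, hu⟩ := hG.exists_measApprox hh
  refine ⟨fun n p => u n p.2, fun n p => e n p.2, fun n => ⟨(hue n).measurable.comp measurable_snd,
    (hue n).measurable_err.comp measurable_snd, fun p => (hue n).abs_le _,
    fun p => (hue n).err_le _, fun p => (hue n).abs_sub_le _⟩,
    he.comp fun n => measurePreserving_snd, ?_⟩
  have := (hu.tendsto.sub_const (∫ y, h y ∂L)).abs
  rw [sub_self, abs_zero] at this
  exact IntegralTendsto.const this

lemma abs_integral_law_le {h : D →ᵇ ℝ} (hh : ∀ y, |h y| ≤ 1) : |∫ y, h y ∂L| ≤ 1 :=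
  abs_integral_le_of_abs_le hh

/-- For every fixed `ω`, sections of the approximation on the product space bring the conditional
mean of `v` within that of `e` of the conditional outer expectation. The latter is within the
bounded-Lipschitz distance of the outer expectation under `G n`, up to scaling. -/
lemma condMeanTendsto_of_boundedLipschitzDist (hG : WeaklyConverges P G L)
    (hd : TendstoZeroInOuterProb P
      (fun n ω => boundedLipschitzDist (Q n) (fun ω₁ => Gb n (ω, ω₁)) (P n) (G n)))
    (hm : AsymptoticallyMeasurable (fun n => (P n).prod (Q n)) Gb)
    {h : D →ᵇ ℝ} (hh : ∀ y, |h y| ≤ 1) {C : NNReal} (hC : LipschitzWith C h) :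
    CondMeanTendsto P Q (fun n p => h (Gb n p)) (∫ y, h y ∂L) := by
  obtain ⟨v, e, hve, he, -⟩ := hm.exists_measApprox hh
  refine ⟨v, e, hve, he, ?_⟩
  set c := ∫ y, h y ∂L with hc
  have hc1 : |c| ≤ 1 := abs_integral_law_le hh
  -- This scaling makes `κ * h` 1-Lipschitz while keeping it bounded by 1.
  set κ : ℝ := (max C 1 : NNReal)⁻¹ with hκ
  have hκ0 : 0 < κ := inv_pos.2 (lt_of_lt_of_le one_pos (by exact_mod_cast le_max_right C 1))
  have hκ1 : κ ≤ 1 := inv_le_one_of_one_le₀ (by exact_mod_cast le_max_right C 1)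
  have hκC : κ * C ≤ 1 := by
    rw [hκ, inv_mul_le_iff₀ (by positivity), mul_one]
    exact_mod_cast le_max_left C 1
  have hBL : (fun y => κ * h y) ∈ BL1 D := by
    refine ⟨LipschitzWith.of_dist_le_mul fun y z => ?_, fun y => ?_⟩
    · rw [Real.dist_eq, ← mul_sub, abs_mul, abs_of_pos hκ0, ← Real.dist_eq]
      calc κ * dist (h y) (h z) ≤ κ * (C * dist y z) :=
            mul_le_mul_of_nonneg_left (hC.dist_le_mul y z) hκ0.le
        _ ≤ _ := by
            rw [← mul_assoc]
            exact mul_le_mul_of_nonneg_right (by simpa using hκC) dist_nonneg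
    · rw [abs_mul, abs_of_pos hκ0]
      exact mul_le_one₀ hκ1 (abs_nonneg _) (hh y)
  have hr := ((hG (κ • h)).sub_const (κ * c)).abs
  have hκc : ∫ y, (κ • h) y ∂L = κ * c := by
    simp [hc, integral_const_mul]
  rw [hκc, sub_self, abs_zero] at hr
  have hE := he.integral_section.const_mul κ
  rw [mul_zero] at hE
  have hV : ∀ n, Measurable fun ω => ∫ ω', v n (ω, ω') ∂Q n := fun n =>
    measurable_integral_section (hve n).measurable
  have hWm : ∀ n, Measurable fun ω => |∫ ω', v n (ω, ω') ∂Q n - c| := fun n =>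
    measurable_abs.comp ((hV n).sub_const c)
  have hW2 : ∀ n ω, |∫ ω', v n (ω, ω') ∂Q n - c| ≤ 2 := fun n ω => by
    have := abs_integral_section_le (Q := Q n) (hve n).abs_le ω
    exact (abs_sub _ _).trans (by linarith)
  have key := tendsto_integral_of_outerProb hE
    (fun n ω => mul_nonneg hκ0.le (integral_nonneg fun ω' => (hve n).err_nonneg _))
    (fun n => (hWm n).const_mul κ) (fun n ω => mul_nonneg hκ0.le (abs_nonneg _))
    (fun n ω => (mul_le_of_le_one_left (abs_nonneg _) hκ1).trans (hW2 n ω)) hr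
    (fun n => abs_nonneg _) hd fun n ω => ?_
  · have := key.const_mul κ⁻¹
    simpa only [mul_zero, inv_mul_cancel_left₀ hκ0.ne'] using this
  · have h1 := le_boundedLipschitzDist (P := Q n) (Q := P n) (X := fun ω₁ => Gb n (ω, ω₁))
      (Y := G n) hBL
    have hvm : Measurable fun ω' => v n (ω, ω') := (hve n).measurable.comp measurable_prodMk_left
    have hem : Measurable fun ω' => e n (ω, ω') :=
      (hve n).measurable_err.comp measurable_prodMk_left
    have h2 := abs_outerExp_sub_integral_le (P := Q n) (f := fun ω' => κ * h (Gb n (ω, ω')))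
      (hvm.const_mul κ) (hem.const_mul κ)
      ((integrable_of_abs_le hvm fun ω' => (hve n).abs_le _).const_mul κ)
      ((integrable_of_abs_le hem fun ω' => (hve n).err_le _).const_mul κ) (fun ω' => by
        rw [← mul_sub, abs_mul, abs_of_pos hκ0]
        exact mul_le_mul_of_nonneg_left ((hve n).abs_sub_le _) hκ0.le)
    rw [integral_const_mul, integral_const_mul] at h2
    have h3 : κ * |∫ ω', v n (ω, ω') ∂Q n - c| = |κ * ∫ ω', v n (ω, ω') ∂Q n - κ * c| := by
      rw [← mul_sub, abs_mul, abs_of_pos hκ0]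
    rw [h3]
    simp only [BoundedContinuousFunction.coe_smul, smul_eq_mul] at *
    rw [abs_sub_comm] at h2
    refine (abs_sub_le _ (outerExp (Q n) fun ω' => κ * h (Gb n (ω, ω'))) _).trans ?_
    refine (add_le_add h2 (abs_sub_le _ (outerExp (P n) fun ω => κ * h (G n ω)) _)).trans ?_
    linarith

omit [IsProbabilityMeasure L] in
-- The joint statement is tested on functions of the middle coordinate alone; the work is to pass
-- between outer expectations on different product spaces.
lemma weaklyConverges_of_joint (hG : WeaklyConverges P G L)
    (hb : RelativelyWeaklyConvergent (fun n => (P n).prod ((Q n).prod (Q n)))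
      (fun n p => (G n p.1, Gb n (p.1, p.2.1), Gb n (p.1, p.2.2)))
      (fun n => (P n).prod ((P n).prod (P n))) (fun n p => (G n p.1, G n p.2.1, G n p.2.2))) :
    WeaklyConverges (fun n => (P n).prod (Q n)) Gb L := by
  intro f
  have hf : ∀ y, |f y| ≤ ‖f‖ := f.norm_coe_le_norm
  have hb' := (tendsto_zero_iff_abs_tendsto_zero _).2
    (hb (f.compContinuous ⟨fun p => p.2.1, by fun_prop⟩))
  simp only [BoundedContinuousFunction.compContinuous_apply, ContinuousMap.coe_mk] at hb'
  have hπ : ∀ n, MeasurePreserving (fun p : Ω n × Ω n × Ω n => p.2.1)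
      ((P n).prod ((P n).prod (P n))) (P n) := fun n =>
    measurePreserving_fst.comp measurePreserving_snd
  have h1 : Tendsto (fun n => outerExp ((P n).prod ((P n).prod (P n)))
      (fun p => f (G n p.2.1))) atTop (𝓝 (∫ x, f x ∂L)) := by
    -- Pulling back along the projection lowers outer and raises inner expectations, and both bounds
    -- have the same limit.
    refine tendsto_of_tendsto_of_tendsto_of_le_of_le (hG.tendsto_innerExp f) (hG f)
      (fun n => ?_) fun n => outerExp_comp_le (hπ n) fun ω => hf (G n ω)
    refine le_trans ?_ (innerExp_le_outerExp fun p => hf _)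
    exact neg_le_neg (outerExp_comp_le (hπ n) (f := fun ω => -f (G n ω)) (M := ‖f‖)
      fun ω => by simpa using hf (G n ω))
  have h2 := hb'.add h1
  simp only [zero_add] at h2
  refine h2.congr fun n => ?_
  simp only [sub_add_cancel]
  -- No limit of inner expectations is known for `Gb` yet, so equality is needed here: the
  -- projection is perfect once the triple product is reassociated.
  refine le_antisymm (outerExp_comp_le (measurePreserving_prod_first (P n) (Q n))
    fun p => hf (Gb n p)) ?_
  refine (outerExp_le_outerExp_fst (Q := Q n) fun p => hf (Gb n p)).trans ?_
  exact outerExp_comp_le (measurePreserving_prodAssoc (P n) (Q n) (Q n))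
    (f := fun p => f (Gb n (p.1, p.2.1))) fun p => hf _

omit [IsProbabilityMeasure L] in
-- Two copies sharing the same data turn a product test function into the second moment of the
-- conditional mean, which forces its variance to vanish.
lemma condMeanTendsto_of_joint (hG : WeaklyConverges P G L)
    (hb : RelativelyWeaklyConvergent (fun n => (P n).prod ((Q n).prod (Q n)))
      (fun n p => (G n p.1, Gb n (p.1, p.2.1), Gb n (p.1, p.2.2)))
      (fun n => (P n).prod ((P n).prod (P n))) (fun n p => (G n p.1, G n p.2.1, G n p.2.2)))
    {h : D →ᵇ ℝ} (hh : ∀ y, |h y| ≤ 1) :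
    CondMeanTendsto P Q (fun n p => h (Gb n p)) (∫ y, h y ∂L) := by
  obtain ⟨v, e, hve, he, hv⟩ := (weaklyConverges_of_joint hG hb).exists_measApprox hh
  obtain ⟨u, e', hue, he', hu⟩ := hG.exists_measApprox hh
  refine ⟨v, e, hve, he, ?_⟩
  set c := ∫ y, h y ∂L with hc
  let f : D × D × D →ᵇ ℝ := h.compContinuous ⟨fun p => p.2.1, by fun_prop⟩ *
    h.compContinuous ⟨fun p => p.2.2, by fun_prop⟩
  have hf : ∀ p, f p = h p.2.1 * h p.2.2 := fun p => rfl
  have hmul : ∀ a b a' b' r s : ℝ, |a| ≤ 1 → |b'| ≤ 1 → |b - b'| ≤ s → |a - a'| ≤ r →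
      |a * b - a' * b'| ≤ r + s := by
    intro a b a' b' r s ha hb' hs hr
    have : a * b - a' * b' = (a - a') * b' + a * (b - b') := by ring
    rw [this]
    refine (abs_add_le _ _).trans (add_le_add ?_ ?_) <;> rw [abs_mul]
    · exact (mul_le_of_le_one_right (abs_nonneg _) hb').trans hr
    · exact (mul_le_of_le_one_left (abs_nonneg _) ha).trans hs
  have hb' := (tendsto_zero_iff_abs_tendsto_zero _).2 (hb f)
  simp only [hf] at hb'
  have hV := hv.integral_section
  have hV1 : ∀ n ω, |∫ ω', v n (ω, ω') ∂Q n| ≤ 1 := fun n ω =>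
    abs_integral_section_le (hve n).abs_le ω
  -- second moment of the independent copies
  have h1 : Tendsto (fun n => outerExp ((P n).prod ((P n).prod (P n)))
      fun p => h (G n p.2.1) * h (G n p.2.2)) atTop (𝓝 (c * c)) := by
    have hE := (he'.comp (fun n => measurePreserving_fst.comp
        (measurePreserving_snd (μ := P n) (ν := (P n).prod (P n))))).add
      (he'.comp (fun n => measurePreserving_snd.comp
        (measurePreserving_snd (μ := P n) (ν := (P n).prod (P n)))))
    rw [add_zero] at hE
    refine IntegralTendsto.tendsto_outerExp (F := fun n p => u n p.2.1 * u n p.2.2) ?_ hE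
      fun n p => hmul _ _ _ _ _ _ (hh _) ((hue n).abs_le _) ((hue n).abs_sub_le _)
        ((hue n).abs_sub_le _)
    have hm : ∀ n, Measurable fun p : Ω n × Ω n => u n p.1 * u n p.2 := fun n =>
      ((hue n).measurable.comp measurable_fst).mul ((hue n).measurable.comp measurable_snd)
    have hI : IntegralTendsto (fun n => (P n).prod (P n))
        (fun n p => u n p.1 * u n p.2) (c * c) := by
      refine ⟨hm, fun n => integrable_of_abs_le (M := 1) (hm n) fun p => ?_, ?_⟩
      · rw [abs_mul]
        exact mul_le_one₀ ((hue n).abs_le _) (abs_nonneg _) ((hue n).abs_le _)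
      · simp only [integral_prod_mul]
        exact hu.tendsto.mul hu.tendsto
    exact hI.comp fun n => measurePreserving_snd
  have h2 := hb'.add h1
  simp only [sub_add_cancel, zero_add] at h2
  have h3 : Tendsto (fun n => ∫ p, 1 * (v n (p.1, p.2.1) * v n (p.1, p.2.2))
      ∂((P n).prod ((Q n).prod (Q n)))) atTop (𝓝 (c * c)) := by
    have hE := (he.comp fun n => measurePreserving_prod_first (P n) (Q n)).add
      (he.comp fun n => measurePreserving_prod_second (P n) (Q n))
    rw [add_zero] at hE
    have hm : ∀ n, Measurable fun p : Ω n × Ω' n × Ω' n =>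
        1 * (v n (p.1, p.2.1) * v n (p.1, p.2.2)) := fun n =>
      (((hve n).measurable.comp (measurePreserving_prod_first (P n) (Q n)).measurable).mul
        ((hve n).measurable.comp (measurePreserving_prod_second (P n) (Q n)).measurable)).const_mul _
    refine tendsto_of_tendsto_of_dist h2 (squeeze_zero (fun _ => dist_nonneg) (fun n => ?_)
      hE.tendsto)
    refine abs_outerExp_sub_integral_le (hm n) (hE.measurable n) (integrable_of_abs_le (hm n)
      (M := 1) fun p => ?_) (hE.integrable n) fun p => ?_
    · rw [one_mul, abs_mul]
      exact mul_le_one₀ ((hve n).abs_le _) (abs_nonneg _) ((hve n).abs_le _)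
    · rw [one_mul]
      exact hmul _ _ _ _ _ _ (hh _) ((hve n).abs_le _) ((hve n).abs_sub_le _)
        ((hve n).abs_sub_le _)
  have h4 : IntegralTendsto P
      (fun n ω => (∫ ω', v n (ω, ω') ∂Q n) * ∫ ω', v n (ω, ω') ∂Q n) (c * c) := by
    refine ⟨fun n => (hV.measurable n).mul (hV.measurable n), fun n => integrable_of_abs_le (M := 1)
      ((hV.measurable n).mul (hV.measurable n)) fun ω => ?_, ?_⟩
    · rw [abs_mul]
      exact mul_le_one₀ (hV1 n ω) (abs_nonneg _) (hV1 n ω)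
    · refine h3.congr fun n => ?_
      rw [integral_mul_mul_section (u := fun _ => 1) measurable_const (hve n).measurable
        (hve n).measurable (by simp) (hve n).abs_le (hve n).abs_le]
      simp only [one_mul]
  -- Expanding the square, the limit is `c² - 2c·c + c² = 0`.
  have h5 := (h4.sub (hV.const_mul (2 * c))).add
    (IntegralTendsto.const (μ := P) (tendsto_const_nhds (x := c * c)))
  have h6 : IntegralTendsto P (fun n ω => (∫ ω', v n (ω, ω') ∂Q n - c) ^ 2) 0 := by
    convert h5 using 1
    · ext n ω; ring
    · ring
  have hWm : ∀ n, Measurable fun ω => |∫ ω', v n (ω, ω') ∂Q n - c| := fun n =>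
    measurable_abs.comp ((hV.measurable n).sub_const c)
  have hWi : ∀ n, Integrable (fun ω => |∫ ω', v n (ω, ω') ∂Q n - c|) (P n) := fun n =>
    ((hV.integrable n).sub (integrable_const c)).abs
  refine ⟨hWm, hWi, ?_⟩
  have h7 := (Real.continuous_sqrt.tendsto 0).comp h6.tendsto
  rw [Real.sqrt_zero] at h7
  refine squeeze_zero (fun n => integral_nonneg fun ω => abs_nonneg _) (fun n => ?_) h7
  refine Real.le_sqrt_of_sq_le ?_
  set a := ∫ ω, |∫ ω', v n (ω, ω') ∂Q n - c| ∂P n with ha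
  -- Nonnegativity of the variance of `|V - c|`, with `V` the conditional mean, bounds the squared
  -- first moment by the second.
  have h8 : 0 ≤ ∫ ω, (|∫ ω', v n (ω, ω') ∂Q n - c| - a) ^ 2 ∂P n :=
    integral_nonneg fun ω => sq_nonneg _
  have h9 : ∫ ω, (|∫ ω', v n (ω, ω') ∂Q n - c| - a) ^ 2 ∂P n
      = ∫ ω, ((∫ ω', v n (ω, ω') ∂Q n - c) ^ 2
        - 2 * a * |∫ ω', v n (ω, ω') ∂Q n - c| + a ^ 2) ∂P n := by
    congr 1
    ext ω
    rw [← sq_abs (∫ ω', v n (ω, ω') ∂Q n - c)]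
    ring
  have h10 : Integrable (fun ω => (∫ ω', v n (ω, ω') ∂Q n - c) ^ 2
      - 2 * a * |∫ ω', v n (ω, ω') ∂Q n - c|) (P n) :=
    (h6.integrable n).sub ((hWi n).const_mul _)
  rw [h9, integral_add h10 (integrable_const _),
    integral_sub (h6.integrable n) ((hWi n).const_mul _), integral_const_mul, ← ha] at h8
  simp only [integral_const, probReal_univ, smul_eq_mul, one_mul] at h8
  linarith

end ConditionalLimits

/-! ### Mass of the limit law outside a compact set. -/

section Tightness

variable {D : Type*} [MetricSpace D] [MeasurableSpace D] [BorelSpace D] {L : Measure D}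
  [IsProbabilityMeasure L]

omit [IsProbabilityMeasure L] [BorelSpace D] in
lemma exists_isCompact_measureReal_compl_le (hL : IsTightMeasureSet {L}) {ε : ℝ} (hε : 0 < ε) :
    ∃ K : Set D, IsCompact K ∧ L.real Kᶜ ≤ ε := by
  obtain ⟨K, hK, h⟩ := isTightMeasureSet_iff_exists_isCompact_measure_compl_le.1 hL
    (ENNReal.ofReal ε) (by simpa)
  exact ⟨K, hK, ENNReal.toReal_le_of_le_ofReal hε.le (h L rfl)⟩

/-- Pointwise, `1 - ∑ φ` vanishes on `K` and is at most 1 elsewhere, so it lies below the indicator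
of `Kᶜ`. -/
lemma one_sub_sum_integral_le {K : Set D} (hK : IsCompact K) {ι : Type*} [Fintype ι]
    {φ : ι → D →ᵇ ℝ} (hφ0 : ∀ a y, 0 ≤ φ a y) (hφK : ∀ y ∈ K, ∑ a, φ a y = 1) :
    1 - ∑ a, ∫ y, φ a y ∂L ≤ L.real Kᶜ := by
  have hi : ∀ a, Integrable (fun y => φ a y) L := fun a => (φ a).integrable L
  have h1 := integral_mono (μ := L) ((integrable_const (1 : ℝ)).sub
    (integrable_finsetSum Finset.univ fun a _ => hi a))
    ((integrable_const (1 : ℝ)).indicator hK.measurableSet.compl) fun y => by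
      by_cases hy : y ∈ K
      · simp [hy, hφK y hy]
      · simp [hy, Finset.sum_nonneg fun a _ => hφ0 a y]
  rw [integral_indicator_const _ hK.measurableSet.compl,
    integral_sub' (integrable_const _) (integrable_finsetSum Finset.univ fun a _ => hi a),
    integral_finsetSum _ fun a _ => hi a] at h1
  simpa using h1

end Tightness

lemma abs_triple_mul_sub_le {a b c a' b' c' r s t : ℝ} (ha : |a| ≤ 1) (hb : |b| ≤ 1)
    (hb' : |b'| ≤ 1) (hc' : |c'| ≤ 1) (hr : |a - a'| ≤ r) (hs : |b - b'| ≤ s)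
    (ht : |c - c'| ≤ t) : |a * (b * c) - a' * (b' * c')| ≤ r + (s + t) := by
  have h : a * (b * c) - a' * (b' * c')
      = (a - a') * (b' * c') + (a * (b - b') * c' + a * b * (c - c')) := by ring
  rw [h]
  refine (abs_add_le _ _).trans (add_le_add ?_ ((abs_add_le _ _).trans (add_le_add ?_ ?_)))
  · rw [abs_mul, abs_mul]
    exact (mul_le_of_le_one_right (abs_nonneg _) (mul_le_one₀ hb' (abs_nonneg _) hc')).trans hr
  · rw [abs_mul, abs_mul]
    exact (mul_le_of_le_one_right (by positivity) hc').trans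
      ((mul_le_of_le_one_left (abs_nonneg _) ha).trans hs)
  · rw [abs_mul, abs_mul]
    exact (mul_le_of_le_one_left (abs_nonneg _) (mul_le_one₀ ha (abs_nonneg _) hb)).trans ht

/-! ### Approximation by combinations of partition functions. -/

section PartitionApproximation

variable {D : Type*} [TopologicalSpace D] {ι : Type*} [Fintype ι] {φ : ι → D →ᵇ ℝ}

lemma partition_abs_le_one (hφ0 : ∀ a y, 0 ≤ φ a y) (hφ1 : ∀ y, ∑ a, φ a y ≤ 1) (a : ι) (y : D) :
    |φ a y| ≤ 1 := by
  rw [abs_of_nonneg (hφ0 a y)]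
  exact (Finset.single_le_sum (fun i _ => hφ0 i y) (Finset.mem_univ a)).trans (hφ1 y)

lemma one_sub_sum_le_of_measApprox {A : Type*} [MeasurableSpace A] {Z : A → D} {u e : ι → A → ℝ}
    (h : ∀ a, MeasApprox (fun x => φ a (Z x)) (u a) (e a)) (x : A) :
    1 - ∑ a, φ a (Z x) ≤ 1 - ∑ a, u a x + ∑ a, e a x := by
  have : ∑ a, u a x ≤ ∑ a, (φ a (Z x) + e a x) :=
    Finset.sum_le_sum fun a _ => by linarith [(abs_le.1 ((h a).abs_sub_le x)).1]
  rw [Finset.sum_add_distrib] at this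
  linarith

/-- A bounded function of three variables is nearly a sum of products over a fine partition. -/
lemma abs_sub_sum_triple_le (hφ0 : ∀ a y, 0 ≤ φ a y) (hφ1 : ∀ y, ∑ a, φ a y ≤ 1)
    {f : D × D × D → ℝ} {M ε : ℝ} (hM : ∀ y, |f y| ≤ M) (hε : 0 ≤ ε) {x : ι → D}
    (hf : ∀ (a b c : ι) (y z w : D), φ a y ≠ 0 → φ b z ≠ 0 → φ c w ≠ 0 →
      |f (y, z, w) - f (x a, x b, x c)| ≤ ε) (y z w : D) :
    |f (y, z, w) - ∑ q : ι × ι × ι, f (x q.1, x q.2.1, x q.2.2) *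
        (φ q.1 y * (φ q.2.1 z * φ q.2.2 w))|
      ≤ ε + M * ((1 - ∑ a, φ a y) + (1 - ∑ a, φ a z) + (1 - ∑ a, φ a w)) := by
  have hsum : ∑ q : ι × ι × ι, φ q.1 y * (φ q.2.1 z * φ q.2.2 w)
      = (∑ a, φ a y) * ((∑ a, φ a z) * ∑ a, φ a w) := by
    rw [Fintype.sum_prod_type, Finset.sum_mul]
    refine Finset.sum_congr rfl fun a _ => ?_
    dsimp only
    rw [← Finset.mul_sum, Fintype.sum_prod_type, Finset.sum_mul]
    simp only [← Finset.mul_sum]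
  have hS0 : ∀ y, 0 ≤ ∑ a, φ a y := fun y => Finset.sum_nonneg fun a _ => hφ0 a y
  have hzw : (∑ a, φ a z) * ∑ a, φ a w ≤ 1 := mul_le_one₀ (hφ1 z) (hS0 w) (hφ1 w)
  have hzw0 : 0 ≤ (∑ a, φ a z) * ∑ a, φ a w := mul_nonneg (hS0 z) (hS0 w)
  have key := abs_sub_sum_mul_le (t := f (y, z, w)) (ε := ε) (M := M)
    (c := fun q : ι × ι × ι => f (x q.1, x q.2.1, x q.2.2))
    (w := fun q : ι × ι × ι => φ q.1 y * (φ q.2.1 z * φ q.2.2 w)) hε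
    (fun q => mul_nonneg (hφ0 _ _) (mul_nonneg (hφ0 _ _) (hφ0 _ _)))
    (by rw [hsum]; exact mul_le_one₀ (hφ1 y) hzw0 hzw)
    (fun q hq => hf _ _ _ _ _ _ (left_ne_zero_of_mul hq)
      (left_ne_zero_of_mul (right_ne_zero_of_mul hq))
      (right_ne_zero_of_mul (right_ne_zero_of_mul hq))) (hM _)
  refine key.trans ?_
  rw [hsum]
  have hM0 : 0 ≤ M := (abs_nonneg _).trans (hM (y, z, w))
  -- A union bound for three numbers in `[0, 1]`.
  have : 1 - (∑ a, φ a y) * ((∑ a, φ a z) * ∑ a, φ a w)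
      ≤ (1 - ∑ a, φ a y) + (1 - ∑ a, φ a z) + (1 - ∑ a, φ a w) := by
    nlinarith [mul_nonneg (sub_nonneg.2 (hφ1 y)) (sub_nonneg.2 hzw),
      mul_nonneg (sub_nonneg.2 (hφ1 z)) (sub_nonneg.2 (hφ1 w))]
  linarith [mul_le_mul_of_nonneg_left this hM0]

/-- A function of small oscillation on the supports of a partition has its outer expectation
determined by those of the members of the partition. -/
lemma abs_outerExp_sub_sum_le (hφ0 : ∀ a y, 0 ≤ φ a y) (hφ1 : ∀ y, ∑ a, φ a y ≤ 1)
    {A : Type*} [MeasurableSpace A] {μ : Measure A} [IsProbabilityMeasure μ] {Z : A → D}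
    {u e : ι → A → ℝ} (hue : ∀ a, MeasApprox (fun x => φ a (Z x)) (u a) (e a))
    {h : D → ℝ} (hh : ∀ y, |h y| ≤ 1) {δ : ℝ} (hδ : 0 ≤ δ) {x : ι → D}
    (hx : ∀ a y, φ a y ≠ 0 → |h y - h (x a)| ≤ δ) :
    |outerExp μ (fun ω => h (Z ω)) - ∑ a, h (x a) * ∫ ω, u a ω ∂μ|
      ≤ ∫ ω, (δ + (1 - ∑ a, u a ω) + 2 * ∑ a, e a ω) ∂μ := by
  have hu : ∀ a, Integrable (u a) μ := fun a =>
    integrable_of_abs_le (hue a).measurable (hue a).abs_le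
  have he : ∀ a, Integrable (e a) μ := fun a =>
    integrable_of_abs_le (hue a).measurable_err (hue a).err_le
  -- The error `e` is counted twice: once for replacing `φ a (Z ω)` by `u a` in the sum, once in the
  -- missing mass.
  have key := abs_outerExp_sub_integral_le (P := μ) (f := fun ω => h (Z ω))
    (u := fun ω => ∑ a, h (x a) * u a ω)
    (e := fun ω => δ + (1 - ∑ a, u a ω) + 2 * ∑ a, e a ω)
    (Finset.measurable_fun_sum _ fun a _ => (hue a).measurable.const_mul _)
    ((measurable_const.add (measurable_const.sub
      (Finset.measurable_fun_sum _ fun a _ => (hue a).measurable))).add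
      ((Finset.measurable_fun_sum _ fun a _ => (hue a).measurable_err).const_mul _))
    (integrable_finsetSum _ fun a _ => (hu a).const_mul _)
    (((integrable_const _).add ((integrable_const _).sub
      (integrable_finsetSum _ fun a _ => hu a))).add
      ((integrable_finsetSum _ fun a _ => he a).const_mul _)) fun ω => ?_
  · rwa [integral_finsetSum _ fun a _ => (hu a).const_mul _,
      Finset.sum_congr rfl fun a _ => integral_const_mul (h (x a)) (u a)] at key
  · have h1 := abs_sub_sum_mul_le (t := h (Z ω)) (c := fun a => h (x a))
      (w := fun a => φ a (Z ω)) hδ (fun a => hφ0 a _) (hφ1 _) (fun a ha => hx a _ ha) (hh _)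
    have h2 : |∑ a, h (x a) * φ a (Z ω) - ∑ a, h (x a) * u a ω| ≤ ∑ a, e a ω := by
      rw [← Finset.sum_sub_distrib]
      refine (Finset.abs_sum_le_sum_abs _ _).trans (Finset.sum_le_sum fun a _ => ?_)
      rw [← mul_sub, abs_mul]
      exact (mul_le_of_le_one_left (abs_nonneg _) (hh _)).trans ((hue a).abs_sub_le ω)
    have h3 := one_sub_sum_le_of_measApprox hue ω
    refine (abs_sub_le _ (∑ a, h (x a) * φ a (Z ω)) _).trans ?_
    linarith

end PartitionApproximation

/-! ### From conditional means to joint and uniform conditional convergence. -/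

section Joint

variable {Ω Ω' : ℕ → Type*} [∀ n, MeasurableSpace (Ω n)] [∀ n, MeasurableSpace (Ω' n)]
  {P : ∀ n, Measure (Ω n)} [∀ n, IsProbabilityMeasure (P n)]
  {Q : ∀ n, Measure (Ω' n)} [∀ n, IsProbabilityMeasure (Q n)]

lemma integralTendsto_of_section {v : ∀ n, Ω n × Ω' n → ℝ} {c : ℝ}
    (hv : ∀ n, Measurable (v n)) (hv1 : ∀ n p, |v n p| ≤ 1)
    (hV : IntegralTendsto P (fun n ω => |∫ ω', v n (ω, ω') ∂Q n - c|) 0) :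
    IntegralTendsto (fun n => (P n).prod (Q n)) v c := by
  have hi : ∀ n, Integrable (v n) ((P n).prod (Q n)) := fun n =>
    integrable_of_abs_le (hv n) (hv1 n)
  refine ⟨hv, hi, ?_⟩
  have h1 := hV.squeeze (W := fun n ω => ∫ ω', v n (ω, ω') ∂Q n - c)
    (fun n => (measurable_integral_section (hv n)).sub_const c) fun n ω => le_rfl
  have h2 := h1.tendsto.add_const c
  rw [zero_add] at h2
  refine h2.congr fun n => ?_
  rw [integral_prod _ (hi n), integral_sub (hi n).integral_prod_left (integrable_const c)]
  simp

/-- By Fubini the integral is `E[u V W]` with `V`, `W` the conditional means. Replacing them by `b`,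
`c` costs at most `E|V - b| + E|W - c|`, all factors being bounded by 1. -/
lemma integralTendsto_triple {u : ∀ n, Ω n → ℝ} {v w : ∀ n, Ω n × Ω' n → ℝ} {a b c : ℝ}
    (hu : IntegralTendsto P u a) (hu1 : ∀ n ω, |u n ω| ≤ 1)
    (hv : ∀ n, Measurable (v n)) (hv1 : ∀ n p, |v n p| ≤ 1)
    (hw : ∀ n, Measurable (w n)) (hw1 : ∀ n p, |w n p| ≤ 1) (hb : |b| ≤ 1) (hc : |c| ≤ 1)
    (hV : IntegralTendsto P (fun n ω => |∫ ω', v n (ω, ω') ∂Q n - b|) 0)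
    (hW : IntegralTendsto P (fun n ω => |∫ ω', w n (ω, ω') ∂Q n - c|) 0) :
    IntegralTendsto (fun n => (P n).prod ((Q n).prod (Q n)))
      (fun n p => u n p.1 * (v n (p.1, p.2.1) * w n (p.1, p.2.2))) (a * (b * c)) := by
  have hVm : ∀ n, Measurable fun ω => ∫ ω', v n (ω, ω') ∂Q n := fun n =>
    measurable_integral_section (hv n)
  have hWm : ∀ n, Measurable fun ω => ∫ ω', w n (ω, ω') ∂Q n := fun n =>
    measurable_integral_section (hw n)
  have h0 := hV.add hW
  rw [add_zero] at h0
  have h1 := h0.squeeze (W := fun n ω => u n ω *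
      ((∫ ω', v n (ω, ω') ∂Q n) * ∫ ω', w n (ω, ω') ∂Q n) - u n ω * (b * c))
    (fun n => ((hu.measurable n).mul ((hVm n).mul (hWm n))).sub
      ((hu.measurable n).mul_const _)) fun n ω => by
      have := abs_triple_mul_sub_le (a := u n ω) (a' := u n ω) (r := 0) (hu1 n ω)
        (abs_integral_section_le (Q := Q n) (hv1 n) ω) hb hc (by simp) le_rfl
        (le_refl |∫ ω', w n (ω, ω') ∂Q n - c|)
      rwa [zero_add] at this
  have h2 := h1.add (hu.const_mul (b * c))
  have hm : ∀ n, Measurable fun p : Ω n × Ω' n × Ω' n =>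
      u n p.1 * (v n (p.1, p.2.1) * w n (p.1, p.2.2)) := fun n =>
    ((hu.measurable n).comp measurable_fst).mul
      (((hv n).comp (measurePreserving_prod_first (P n) (Q n)).measurable).mul
        ((hw n).comp (measurePreserving_prod_second (P n) (Q n)).measurable))
  refine ⟨hm, fun n => integrable_of_abs_le (M := 1) (hm n) fun p => ?_, ?_⟩
  · rw [abs_mul, abs_mul]
    exact mul_le_one₀ (hu1 _ _) (by positivity)
      (mul_le_one₀ (hv1 _ _) (abs_nonneg _) (hw1 _ _))
  · have h3 := h2.tendsto
    rw [zero_add, mul_comm (b * c) a] at h3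
    refine h3.congr fun n => ?_
    rw [integral_mul_mul_section (hu.measurable n) (hv n) (hw n) (hu1 n) (hv1 n) (hw1 n)]
    congr 1
    ext ω
    ring

variable {D : Type*} [MetricSpace D] [MeasurableSpace D] {L : Measure D} [IsProbabilityMeasure L]
  {G : ∀ n, Ω n → D} {Gb : ∀ n, Ω n × Ω' n → D}

/-- The approximating sum involves only `f`, the partition and `L`, not the bootstrap, so two
bootstraps with the same limits can be compared through it. The factor 3 counts the mass missed in
each coordinate. -/
lemma eventually_outerExp_joint {ι : Type*} [Fintype ι] {φ : ι → D →ᵇ ℝ} {x : ι → D}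
    (hφ0 : ∀ a y, 0 ≤ φ a y) (hφ1 : ∀ y, ∑ a, φ a y ≤ 1) {f : D × D × D → ℝ} {M ε : ℝ}
    (hM : ∀ y, |f y| ≤ M) (hε : 0 ≤ ε)
    (hf : ∀ (a b c : ι) (y z w : D), φ a y ≠ 0 → φ b z ≠ 0 → φ c w ≠ 0 →
      |f (y, z, w) - f (x a, x b, x c)| ≤ ε)
    (hG : WeaklyConverges P G L)
    (hc : ∀ a, CondMeanTendsto P Q (fun n p => φ a (Gb n p)) (∫ y, φ a y ∂L))
    {η : ℝ} (hη : 0 < η) :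
    ∀ᶠ n in atTop, |outerExp ((P n).prod ((Q n).prod (Q n)))
        (fun p => f (G n p.1, Gb n (p.1, p.2.1), Gb n (p.1, p.2.2)))
        - ∑ q : ι × ι × ι, f (x q.1, x q.2.1, x q.2.2) *
          ((∫ y, φ q.1 y ∂L) * ((∫ y, φ q.2.1 y ∂L) * ∫ y, φ q.2.2 y ∂L))|
      ≤ ε + 3 * M * (1 - ∑ a, ∫ y, φ a y ∂L) + η := by
  have hφa := partition_abs_le_one hφ0 hφ1
  choose u e hue he hu using fun a => hG.exists_measApprox (hφa a)
  choose v d hvd hd hV using hc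
  have hv : ∀ a, IntegralTendsto (fun n => (P n).prod (Q n)) (v a) (∫ y, φ a y ∂L) := fun a =>
    integralTendsto_of_section (fun n => (hvd a n).measurable) (fun n => (hvd a n).abs_le) (hV a)
  have hF := IntegralTendsto.sum fun q : ι × ι × ι =>
    (integralTendsto_triple (hu q.1) (fun n => (hue q.1 n).abs_le)
      (fun n => (hvd q.2.1 n).measurable) (fun n => (hvd q.2.1 n).abs_le)
      (fun n => (hvd q.2.2 n).measurable) (fun n => (hvd q.2.2 n).abs_le)
      (abs_integral_law_le (hφa q.2.1)) (abs_integral_law_le (hφa q.2.2)) (hV q.2.1)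
      (hV q.2.2)).const_mul (f (x q.1, x q.2.1, x q.2.2))
  have hπ0 : ∀ n, MeasurePreserving (fun p : Ω n × Ω' n × Ω' n => p.1)
    ((P n).prod ((Q n).prod (Q n))) (P n) := fun n => measurePreserving_fst
  have hπ1 := fun n => measurePreserving_prod_first (P n) (Q n)
  have hπ2 := fun n => measurePreserving_prod_second (P n) (Q n)
  have one : ∀ c : ℝ, IntegralTendsto (fun n => (P n).prod ((Q n).prod (Q n)))
    (fun _ _ => c) c := fun c => IntegralTendsto.const tendsto_const_nhds
  have hs0 := ((one 1).sub (IntegralTendsto.sum fun a => (hu a).comp hπ0)).add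
    (IntegralTendsto.sum fun a => (he a).comp hπ0)
  have hs1 := ((one 1).sub (IntegralTendsto.sum fun a => (hv a).comp hπ1)).add
    (IntegralTendsto.sum fun a => (hd a).comp hπ1)
  have hs2 := ((one 1).sub (IntegralTendsto.sum fun a => (hv a).comp hπ2)).add
    (IntegralTendsto.sum fun a => (hd a).comp hπ2)
  have hE := ((one ε).add (((hs0.add hs1).add hs2).const_mul M)).add
    (IntegralTendsto.sum fun q : ι × ι × ι => (((he q.1).comp hπ0).add
      (((hd q.2.1).comp hπ1).add ((hd q.2.2).comp hπ2))).const_mul M)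
  have hE' := hE.congr_limit (c' := ε + 3 * M * (1 - ∑ a, ∫ y, φ a y ∂L)) (by
    simp only [Finset.sum_const_zero, add_zero, mul_zero]; ring)
  refine hF.eventually_outerExp_le hE' (fun n p => ?_) hη
  have hM0 : 0 ≤ M := (abs_nonneg _).trans (hM (G n p.1, G n p.1, G n p.1))
  have h1 := abs_sub_sum_triple_le hφ0 hφ1 hM hε hf (G n p.1) (Gb n (p.1, p.2.1))
    (Gb n (p.1, p.2.2))
  have h2 := mul_le_mul_of_nonneg_left (add_le_add (add_le_add
    (one_sub_sum_le_of_measApprox (fun a => hue a n) p.1)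
    (one_sub_sum_le_of_measApprox (fun a => hvd a n) (p.1, p.2.1)))
    (one_sub_sum_le_of_measApprox (fun a => hvd a n) (p.1, p.2.2))) hM0
  refine (abs_sub_le _ (∑ q : ι × ι × ι, f (x q.1, x q.2.1, x q.2.2) *
    (φ q.1 (G n p.1) * (φ q.2.1 (Gb n (p.1, p.2.1)) * φ q.2.2 (Gb n (p.1, p.2.2))))) _).trans ?_
  refine add_le_add (h1.trans (by linarith)) ?_
  rw [← Finset.sum_sub_distrib]
  refine (Finset.abs_sum_le_sum_abs _ _).trans (Finset.sum_le_sum fun q _ => ?_)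
  rw [← mul_sub, abs_mul]
  exact mul_le_mul (hM _) (abs_triple_mul_sub_le (hφa _ _) (hφa _ _) ((hvd _ n).abs_le _)
    ((hvd _ n).abs_le _) ((hue _ n).abs_sub_le _) ((hvd _ n).abs_sub_le _)
    ((hvd _ n).abs_sub_le _)) (abs_nonneg _) hM0

variable [BorelSpace D]

/-- Lipschitz test functions suffice because the partition of unity is Lipschitz; this is what
condition (a) can supply. -/
theorem relativelyWeaklyConvergent_of_condMeanTendsto (hL : IsTightMeasureSet {L})
    (hG : WeaklyConverges P G L)
    (hc : ∀ h : D →ᵇ ℝ, (∀ y, |h y| ≤ 1) → (∃ C, LipschitzWith C h) →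
      CondMeanTendsto P Q (fun n p => h (Gb n p)) (∫ y, h y ∂L)) :
    RelativelyWeaklyConvergent (fun n => (P n).prod ((Q n).prod (Q n)))
      (fun n p => (G n p.1, Gb n (p.1, p.2.1), Gb n (p.1, p.2.2)))
      (fun n => (P n).prod ((P n).prod (P n))) (fun n p => (G n p.1, G n p.2.1, G n p.2.2)) := by
  intro f
  have hM : ∀ y, |f y| ≤ ‖f‖ := f.norm_coe_le_norm
  refine Metric.tendsto_nhds.2 fun r hr => ?_
  -- Each of the two comparisons below costs at most `ε + 3 * ‖f‖ * ε + ε`, and twice this is less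
  -- than `8 * ε * (1 + ‖f‖) = r`.
  set ε : ℝ := r / (8 * (1 + ‖f‖)) with hεdef
  have hε : 0 < ε := by positivity
  have hεr : 8 * (ε + ε * ‖f‖) = r := by
    rw [hεdef]; field_simp
  obtain ⟨K, hK, hKε⟩ := exists_isCompact_measureReal_compl_le hL hε
  -- Uniform continuity of `f` at the points of `K³`: only one of the two points must lie in `K³`,
  -- which suits balls centred in `K`.
  obtain ⟨δ, hδ, hfδ⟩ := Metric.mem_uniformity_dist.1
    ((hK.prod (hK.prod hK)).uniformContinuousAt_of_continuousAt f
      (fun _ _ => f.continuous.continuousAt) (Metric.dist_mem_uniformity hε))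
  obtain ⟨s, φ, hsK, hφ0, hφ1, hφK, hφδ, hφl⟩ := exists_lipschitz_partition hK hδ
  have hφa := partition_abs_le_one hφ0 hφ1
  have htail := one_sub_sum_integral_le (L := L) hK hφ0 hφK
  have hf : ∀ (a b c : s) (y z w : D), φ a y ≠ 0 → φ b z ≠ 0 → φ c w ≠ 0 →
      |f (y, z, w) - f ((a : D), (b : D), (c : D))| ≤ ε := by
    intro a b c y z w ha hb hc'
    have hdist : dist ((a : D), (b : D), (c : D)) (y, z, w) < δ :=
      max_lt (hφδ a y ha) (max_lt (hφδ b z hb) (hφδ c w hc'))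
    have h1 : dist (f ((a : D), (b : D), (c : D))) (f (y, z, w)) < ε :=
      hfδ hdist ⟨hsK a, hsK b, hsK c⟩
    rw [abs_sub_comm, ← Real.dist_eq]
    exact h1.le
  filter_upwards [eventually_outerExp_joint (x := fun a : s => (a : D)) hφ0 hφ1 hM hε.le hf hG
      (fun a => hc (φ a) (hφa a) (hφl a)) hε,
    eventually_outerExp_joint (x := fun a : s => (a : D)) hφ0 hφ1 hM hε.le hf hG
      (fun a => condMeanTendsto_snd hG (hφa a)) hε] with n h1 h2
  rw [Real.dist_eq, sub_zero, abs_abs]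
  rw [abs_sub_comm] at h2
  refine (abs_sub_le _ _ _).trans_lt ((add_le_add h1 h2).trans_lt ?_)
  have h3 := mul_le_mul_of_nonneg_left (htail.trans hKε) (norm_nonneg f)
  nlinarith [mul_nonneg hε.le (norm_nonneg f)]

/-- Every `h ∈ BL1` oscillates by at most `ε` on each support of a partition of mesh `ε`. One finite
partition thus bounds the whole supremum by a single measurable function, to which Markov's
inequality applies. -/
theorem tendstoZeroInOuterProb_of_condMeanTendsto (hL : IsTightMeasureSet {L})
    (hG : WeaklyConverges P G L)
    (hc : ∀ h : D →ᵇ ℝ, (∀ y, |h y| ≤ 1) →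
      CondMeanTendsto P Q (fun n p => h (Gb n p)) (∫ y, h y ∂L)) :
    TendstoZeroInOuterProb P
      (fun n ω => boundedLipschitzDist (Q n) (fun ω₁ => Gb n (ω, ω₁)) (P n) (G n)) := by
  intro r hr
  refine ENNReal.tendsto_nhds_zero.2 fun t ht => ?_
  obtain ⟨τ, hτ0, hτ⟩ : ∃ τ : ℝ, 0 < τ ∧ ENNReal.ofReal τ ≤ t := by
    rcases eq_or_ne t ⊤ with rfl | htop
    · exact ⟨1, one_pos, le_top⟩
    · exact ⟨t.toReal, ENNReal.toReal_pos ht.ne' htop, ENNReal.ofReal_toReal_le⟩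
  -- The mean of the bound `B` has limit at most `4 * ε`; a further `4 * ε` of tolerance gives `8 *
  -- ε = r * τ`, and Markov's inequality divides by `r`.
  set ε : ℝ := r * τ / 8 with hεdef
  have hε : 0 < ε := by positivity
  obtain ⟨K, hK, hKε⟩ := exists_isCompact_measureReal_compl_le hL hε
  obtain ⟨s, φ, hsK, hφ0, hφ1, hφK, hφδ, -⟩ := exists_lipschitz_partition hK hε
  have hφa := partition_abs_le_one hφ0 hφ1
  have htail := one_sub_sum_integral_le (L := L) hK hφ0 hφK
  choose u e hue he hu using fun a => hG.exists_measApprox (hφa a)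
  choose v d hvd hd hV using fun a => hc (φ a) (hφa a)
  have hv : ∀ a, IntegralTendsto (fun n => (P n).prod (Q n)) (v a) (∫ y, φ a y ∂L) := fun a =>
    integralTendsto_of_section (fun n => (hvd a n).measurable) (fun n => (hvd a n).abs_le) (hV a)
  have hE1 := (((IntegralTendsto.const (tendsto_const_nhds (x := ε))).add
    ((IntegralTendsto.const (tendsto_const_nhds (x := (1 : ℝ)))).sub
      (IntegralTendsto.sum hv))).add ((IntegralTendsto.sum hd).const_mul 2)).integral_section
  have hE2 := IntegralTendsto.const (μ := P) ((((IntegralTendsto.const (μ := P)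
    (tendsto_const_nhds (x := ε))).add
    ((IntegralTendsto.const (tendsto_const_nhds (x := (1 : ℝ)))).sub
      (IntegralTendsto.sum hu))).add ((IntegralTendsto.sum he).const_mul 2)).tendsto)
  have hE3 := IntegralTendsto.sum fun a => (hV a).add (IntegralTendsto.const (μ := P)
    (((hu a).tendsto.sub_const (∫ y, φ a y ∂L)).abs))
  have hB := (hE1.add hE2).add hE3
  simp only [Finset.sum_const_zero, mul_zero, add_zero, sub_self, abs_zero] at hB
  filter_upwards [Metric.tendsto_nhds.1 hB.tendsto (4 * ε) (by positivity)] with n hn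
  let B : Ω n → ℝ := fun ω =>
      (∫ ω', (ε + (1 - ∑ a, v a n (ω, ω')) + 2 * ∑ a, d a n (ω, ω')) ∂Q n)
        + (∫ ω, (ε + (1 - ∑ a, u a n ω) + 2 * ∑ a, e a n ω) ∂P n)
        + ∑ a, (|∫ ω', v a n (ω, ω') ∂Q n - ∫ y, φ a y ∂L|
          + |∫ ω, u a n ω ∂P n - ∫ y, φ a y ∂L|)
  have hbound : ∀ ω, boundedLipschitzDist (Q n) (fun ω₁ => Gb n (ω, ω₁)) (P n) (G n) ≤ B ω := by
    intro ω
    have key : ∀ h ∈ BL1 D, |outerExp (Q n) (fun ω₁ => h (Gb n (ω, ω₁)))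
        - outerExp (P n) (fun ω₀ => h (G n ω₀))| ≤ B ω := by
      intro h hh
      have hx : ∀ a y, φ a y ≠ 0 → |h y - h a| ≤ ε := fun a y ha => by
        have := hh.1.dist_le_mul y a
        rw [NNReal.coe_one, one_mul, dist_comm y, Real.dist_eq] at this
        exact this.trans (hφδ a y ha).le
      have h1 := abs_outerExp_sub_sum_le (μ := Q n) (Z := fun ω₁ => Gb n (ω, ω₁))
        (u := fun a ω' => v a n (ω, ω')) (e := fun a ω' => d a n (ω, ω')) hφ0 hφ1
        (fun a => ⟨(hvd a n).measurable.comp measurable_prodMk_left,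
          (hvd a n).measurable_err.comp measurable_prodMk_left, fun _ => (hvd a n).abs_le _,
          fun _ => (hvd a n).err_le _, fun _ => (hvd a n).abs_sub_le _⟩) hh.2 hε.le hx
      have h2 := abs_outerExp_sub_sum_le (μ := P n) hφ0 hφ1 (fun a => hue a n) hh.2 hε.le hx
      have h3 : |∑ a : s, h a * (∫ ω', v a n (ω, ω') ∂Q n) - ∑ a : s, h a * ∫ ω, u a n ω ∂P n|
          ≤ ∑ a : s, (|∫ ω', v a n (ω, ω') ∂Q n - ∫ y, φ a y ∂L|
            + |∫ ω, u a n ω ∂P n - ∫ y, φ a y ∂L|) := by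
        rw [← Finset.sum_sub_distrib]
        refine (Finset.abs_sum_le_sum_abs _ _).trans (Finset.sum_le_sum fun a _ => ?_)
        rw [← mul_sub, abs_mul]
        refine (mul_le_of_le_one_left (abs_nonneg _) (hh.2 _)).trans ?_
        rw [abs_sub_comm (∫ ω, u a n ω ∂P n)]
        exact abs_sub_le _ _ _
      rw [abs_sub_comm] at h2
      refine (abs_sub_le _ (∑ a : s, h a * ∫ ω', v a n (ω, ω') ∂Q n) _).trans
        ((add_le_add h1 ((abs_sub_le _ (∑ a : s, h a * ∫ ω, u a n ω ∂P n) _).trans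
          (add_le_add h3 h2))).trans ?_)
      dsimp only [B]
      linarith
    -- `Real.iSup_le` also asks for a nonnegative bound, which testing on `h = 0` provides.
    refine Real.iSup_le (fun h => key h.1 h.2) ((abs_nonneg _).trans (key 0 ?_))
    exact ⟨LipschitzWith.const' 0, by simp⟩
  have hd0 : ∀ ω, 0 ≤ boundedLipschitzDist (Q n) (fun ω₁ => Gb n (ω, ω₁)) (P n) (G n) :=
    fun ω => Real.iSup_nonneg fun _ => abs_nonneg _
  have hmarkov := mul_meas_ge_le_integral_of_nonneg (μ := P n) (f := B)
    (.of_forall fun ω => (hd0 ω).trans (hbound ω)) (hB.integrable n) r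
  rw [Real.dist_eq] at hn
  have hsub : {ω | r < |boundedLipschitzDist (Q n) (fun ω₁ => Gb n (ω, ω₁)) (P n) (G n)|}
      ⊆ {ω | r ≤ B ω} := by
    intro ω hω
    rw [Set.mem_ofPred_eq, abs_of_nonneg (hd0 ω)] at hω
    exact hω.le.trans (hbound ω)
  refine (measure_mono hsub).trans (le_trans ((ENNReal.le_ofReal_iff_toReal_le
    (measure_ne_top _ _) hτ0.le).2 ?_) hτ)
  have h1 := (abs_lt.1 hn).2
  refine le_of_mul_le_mul_left (hmarkov.trans ?_) hr
  have : r * τ = 8 * ε := by rw [hεdef]; ring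
  rw [this]
  linarith

end Joint

/-! ### Subsequences and the equivalence. -/

section Equivalence

variable {Ω Ω' : ℕ → Type*} [∀ n, MeasurableSpace (Ω n)] [∀ n, MeasurableSpace (Ω' n)]
  {P : ∀ n, Measure (Ω n)} [∀ n, IsProbabilityMeasure (P n)]
  {Q : ∀ n, Measure (Ω' n)} [∀ n, IsProbabilityMeasure (Q n)]
  {D : Type*} [MetricSpace D] [MeasurableSpace D] [BorelSpace D]
  {G : ∀ n, Ω n → D} {Gb : ∀ n, Ω n × Ω' n → D}

omit [∀ n, IsProbabilityMeasure (P n)] [BorelSpace D] in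
lemma RelativelyCompact.tendsto_of_weaklyConverges (hrc : RelativelyCompact P G)
    {β : Type*} {l : Filter β} {x : ℕ → β}
    (h : ∀ (σ : ℕ → ℕ) (L : Measure D), StrictMono σ → IsProbabilityMeasure L →
      IsTightMeasureSet {L} → WeaklyConverges (fun k => P (σ k)) (fun k => G (σ k)) L →
      Tendsto (fun k => x (σ k)) atTop l) : Tendsto x atTop l := by
  refine tendsto_of_subseq_tendsto fun ns hns => ?_
  -- Relative compactness speaks of strictly increasing indices only, so the given sequence of
  -- indices is thinned first.
  obtain ⟨φ, hφ, hnsφ⟩ := strictMono_subseq_of_tendsto_atTop hns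
  obtain ⟨ψ, hψ, L, hLp, hLt, hLw⟩ := hrc (ns ∘ φ) hnsφ
  exact ⟨φ ∘ ψ, h _ L (hnsφ.comp hψ) hLp hLt hLw⟩

/-- Conditional weak convergence of `Gb` given the first coordinate is equivalent to joint
unconditional weak convergence with two conditionally independent copies. -/
theorem RelativelyCompact.conditional_iff_joint (hrc : RelativelyCompact P G) :
    (TendstoZeroInOuterProb P
        (fun n ω => boundedLipschitzDist (Q n) (fun ω₁ => Gb n (ω, ω₁)) (P n) (G n)) ∧
      AsymptoticallyMeasurable (fun n => (P n).prod (Q n)) Gb) ↔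
    RelativelyWeaklyConvergent (fun n => (P n).prod ((Q n).prod (Q n)))
      (fun n p => (G n p.1, Gb n (p.1, p.2.1), Gb n (p.1, p.2.2)))
      (fun n => (P n).prod ((P n).prod (P n))) (fun n p => (G n p.1, G n p.2.1, G n p.2.2)) := by
  constructor
  · rintro ⟨hd, hm⟩ f
    -- The law `L` may change with the subsequence; this is harmless, since the limit 0 to be proved
    -- does not involve it.
    refine hrc.tendsto_of_weaklyConverges fun σ L hσ hLp hLt hLw => ?_
    exact relativelyWeaklyConvergent_of_condMeanTendsto (Q := fun k => Q (σ k))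
      (Gb := fun k => Gb (σ k)) hLt hLw (fun h hh ⟨C, hC⟩ =>
        condMeanTendsto_of_boundedLipschitzDist hLw
          (fun ε hε => (hd ε hε).comp hσ.tendsto_atTop)
          (fun g => (hm g).comp hσ.tendsto_atTop) hh hC) f
  · intro hb
    refine ⟨fun ε hε => hrc.tendsto_of_weaklyConverges fun σ L hσ hLp hLt hLw => ?_,
      fun f => hrc.tendsto_of_weaklyConverges fun σ L hσ hLp hLt hLw => ?_⟩
    · exact tendstoZeroInOuterProb_of_condMeanTendsto (Q := fun k => Q (σ k))
        (Gb := fun k => Gb (σ k)) hLt hLw (fun h hh => condMeanTendsto_of_joint hLw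
          (fun g => (hb g).comp hσ.tendsto_atTop) hh) ε hε
    · exact (weaklyConverges_of_joint (Q := fun k => Q (σ k)) (Gb := fun k => Gb (σ k)) hLw
        (fun g => (hb g).comp hσ.tendsto_atTop)).asymptoticallyMeasurable f

end Equivalence

/-- The data `X n` live on `(Ω n, P n)` and one copy of the bootstrap variables `V n` lives on
`(Ω' n, Q n)`. The data and two independent copies of `V n`, jointly independent, are realised on
the product space `Ω n × Ω' n × Ω' n`: at `(ω, ω₁, ω₂)` they are `X n ω`, `V n ω₁`, `V n ω₂`.
With `G n` and `Gb n` the statistics, `𝔾_n = G n (X n ω)` and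
`𝔾_n^{(j)} = Gb n (X n ω) (V n ω_j)`. The conditional (outer) expectation given the data is the
outer expectation over `ω₁` for fixed `ω`. -/
theorem mainTheorem9 {T : Type*} {Ω Ω' 𝒳 𝒱 : ℕ → Type*}
    [∀ n, MeasurableSpace (Ω n)] [∀ n, MeasurableSpace (Ω' n)]
    [∀ n, MeasurableSpace (𝒳 n)] [∀ n, MeasurableSpace (𝒱 n)]
    (P : ∀ n, Measure (Ω n)) [∀ n, IsProbabilityMeasure (P n)]
    (Q : ∀ n, Measure (Ω' n)) [∀ n, IsProbabilityMeasure (Q n)]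
    (X : ∀ n, Ω n → 𝒳 n) (hX : ∀ n, Measurable (X n))
    (V : ∀ n, Ω' n → 𝒱 n) (hV : ∀ n, Measurable (V n))
    (G : ∀ n, 𝒳 n → LInf T) (Gb : ∀ n, 𝒳 n → 𝒱 n → LInf T)
    (hG : ∀ n (t : T), Measurable (fun ω : Ω n => G n (X n ω) t))
    (hGb : ∀ n (t : T), Measurable (fun p : Ω n × Ω' n => Gb n (X n p.1) (V n p.2) t))
    (hrc : RelativelyCompact P (fun n ω => G n (X n ω))) :
    (TendstoZeroInOuterProb P
        (fun n ω => boundedLipschitzDist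
          (Q n) (fun ω₁ => Gb n (X n ω) (V n ω₁))
          (P n) (fun ω₀ => G n (X n ω₀))) ∧
      AsymptoticallyMeasurable (fun n => (P n).prod (Q n))
        (fun n p => Gb n (X n p.1) (V n p.2)))
    ↔
    RelativelyWeaklyConvergent
      (fun n => (P n).prod ((Q n).prod (Q n)))
      (fun n p => (G n (X n p.1), Gb n (X n p.1) (V n p.2.1), Gb n (X n p.1) (V n p.2.2)))
      (fun n => (P n).prod ((P n).prod (P n)))
      (fun n p => (G n (X n p.1), G n (X n p.2.1), G n (X n p.2.2))) :=
  hrc.conditional_iff_joint (Gb := fun n p => Gb n (X n p.1) (V n p.2))
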